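/- **Setting.** Let $D\subset\mathbb R^d$ be a bounded open set (for instance a bounded domain with Lipschitz boundary), let $\delta>0$, and let $\overline D$ be its closure. $\mathscr M^+(\overline D)$, $\mathscr M(\overline D)$, $\mathscr M(\overline D;\mathbb R^d)$ denote the finite positive, signed and $\mathbb R^d$-valued Borel measures on the compact set $\overline D$; weak$^*$ convergence is in duality with continuous functions on $\overline D$ (respectively on $[0,1]\times\overline D$). Let $\mathscr L$ be Lebesgue measure on $\overline D$. For $\mu\in\mathscr M^+(\overline D)$, $\nu\in\mathscr M(\overline D;\mathbb R^d)$, $\zeta\in\mathscr M(\overline D)$ write the Lebesgue decompositions $\mu=u\mathscr L+\mu^\perp$, $\nu=w\mathscr L+\nu^\perp$, $\zeta=z\mathscr L+\zeta^\perp$, put $\mathscr L^\perp=\mu^\perp+|\nu^\perp|$, $\mu^\perp=u^\perp\mathscr L^\perp$, $\nu^\perp=w^\perp\mathscr L^\perp$, and define $$\mathcal D(\mu,\nu,\zeta)=\int\phi(u,w)\,d\mathscr L+\int\phi(u^\perp,w^\perp)\,d\mathscr L^\perp+\frac1\delta\mathcal A_Z(\zeta),$$ where $\phi(u,w)=|w|^2/u$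 if $u>0$, $\phi(0,0)=0$, $\phi(0,w)=+\infty$ if $w\ne0$, and $\mathcal A_Z(\zeta)=\int z^2\,d\mathscr L$ if $\zeta^\perp=0$, $\mathcal A_Z(\zeta)=+\infty$ otherwise. We write $(\mu_t,\nu_t,\zeta_t)_{t}\in\mathcal{CE}[0,1]$ if $[0,1]\ni t\mapsto\mu_t\in\mathscr M^+(\overline D)$ is weak$^*$ continuous, $t\mapsto\nu_t\in\mathscr M(\overline D;\mathbb R^d)$ and $t\mapsto\zeta_t\in\mathscr M(\overline D)$ are Borel, $\int_0^1|\nu_t|(\overline D)\,dt<\infty$, $\int_0^1|\zeta_t|(\overline D)\,dt<\infty$, and $$\int_0^1\!\!\int_{\overline D}\partial_t\eta\,d\mu_t\,dt+\int_0^1\!\!\int_{\overline D}\nabla\eta\cdot d\nu_t\,dt+\int_0^1\!\!\int_{\overline D}\eta\,d\zeta_t\,dt=0$$ for all $\eta\in C^1_c((0,1)\times\overline D)$, i.e. restrictions of $C^1$ functions with compact support in $(0,1)\times\mathbb R^d$. **Proposition (Compactness for solutions to the continuity equation with bounded action).** Let $(\mu^n_t,\nu^n_t,\zeta^n_t)_{t}\in\mathcal{CE}[0,1]$,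 $n\in\mathbb N$, satisfy $$\sup_n\mu_0^n(\overline D)<\infty,\qquad \sup_n\int_0^1\mathcal D(\mu^n_t,\nu^n_t,\zeta^n_t)\,dt<\infty .$$ Set $\boldsymbol\nu^n=\int_0^1\delta_t\otimes\nu^n_t\,dt\in\mathscr M([0,1]\times\overline D;\mathbb R^d)$ and $\boldsymbol\zeta^n=\int_0^1\delta_t\otimes\zeta^n_t\,dt\in\mathscr M([0,1]\times\overline D)$. Then there exist a subsequence (not relabelled) and a triple $(\mu_t,\nu_t,\zeta_t)_{t}\in\mathcal{CE}[0,1]$ such that, with $\boldsymbol\nu=\int_0^1\delta_t\otimes\nu_t\,dt$ and $\boldsymbol\zeta=\int_0^1\delta_t\otimes\zeta_t\,dt$, 1. $\mu^n_t\rightharpoonup^*\mu_t$ in $\mathscr M^+(\overline D)$ for every $t\in[0,1]$; 2. $\boldsymbol\nu^n\rightharpoonup^*\boldsymbol\nu$ in $\mathscr M([0,1]\times\overline D;\mathbb R^d)$; 3. $\boldsymbol\zeta^n\rightharpoonup^*\boldsymbol\zeta$ in $\mathscr M([0,1]\times\overline D)$; and along this subsequence $$\int_0^1\mathcal D(\mu_t,\nu_t,\zeta_t)\,dt\le\liminf_{n\to\infty}\int_0^1\mathcal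 D(\mu^n_t,\nu^n_t,\zeta^n_t)\,dt .$$ -/

import Mathlib

open MeasureTheory Filter Topology Set unitInterval
open scoped ENNReal

noncomputable section

/-! ### Vector measures with values in a finite-dimensional inner product space -/

section VectorMeasures

variable {X : Type*} [MeasurableSpace X]
variable {V : Type*} [NormedAddCommGroup V] [InnerProductSpace ℝ V]

/-- The pairing `∫ ⟨f, dν⟩` of a vector field `f` with a `V`-valued measure `ν`.
For `V = ℝ` this is the integral of `f` against the signed measure `ν`. -/
def pairing (f : X → V) (ν : VectorMeasure X V) : ℝ :=
  ∫ᵛ x, f x ∂[innerSL ℝ; ν]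

/-- Weak-* convergence of `V`-valued measures on a compact space `X`:
convergence of the pairings with all continuous functions `X → V`. -/
def WeakStarTendsto [TopologicalSpace X] (ρ : ℕ → VectorMeasure X V)
    (ρlim : VectorMeasure X V) : Prop :=
  ∀ f : C(X, V), Tendsto (fun n => pairing f (ρ n)) atTop (𝓝 (pairing f ρlim))

/-- A vector measure with values in a finite-dimensional space has finite total variation. -/
instance isFiniteMeasure_variation [FiniteDimensional ℝ V] (ν : VectorMeasure X V) :
    IsFiniteMeasure ν.variation := by
  let b := stdOrthonormalBasis ℝ V
  let c : Fin (Module.finrank ℝ V) → SignedMeasure X := fun i =>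
    ν.mapRange (innerSL ℝ (b i)).toLinearMap.toAddMonoidHom (innerSL ℝ (b i)).continuous
  have key : ν.variation ≤ ∑ i, (c i).totalVariation := by
    refine VectorMeasure.variation_le_of_forall_enorm_le fun A _ => ?_
    have h1 : ‖ν A‖ₑ ≤ ∑ i, ‖inner ℝ (b i) (ν A)‖ₑ := by
      conv_lhs => rw [← b.sum_repr' (ν A)]
      refine (enorm_sum_le _ _).trans (Finset.sum_le_sum fun i _ => ?_)
      rw [enorm_smul]
      have : ‖b i‖ₑ = 1 := by
        rw [← ofReal_norm, b.orthonormal.1 i, ENNReal.ofReal_one]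
      rw [this, mul_one]
    refine h1.trans ?_
    rw [Measure.finsetSum_apply]
    exact Finset.sum_le_sum fun i _ => SignedMeasure.enorm_le_totalVariation (c i) A
  have : ∀ i, IsFiniteMeasure (c i).totalVariation := fun i => by
    unfold SignedMeasure.totalVariation; infer_instance
  exact isFiniteMeasure_of_le _ key

end VectorMeasures

/-! ### Time-dependent families of vector measures and their space-time measures -/

section SpaceTime

variable {X : Type*} [MeasurableSpace X]
variable {V : Type*} [NormedAddCommGroup V] [InnerProductSpace ℝ V] [FiniteDimensional ℝ V]
  [MeasurableSpace V] [BorelSpace V]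

/-- A Borel family `(ν_t)_{t ∈ [0,1]}` of vector measures: `t ↦ ν_t(B)` is Borel for every Borel
set `B` (on a compact metric space, this says that `t ↦ ν_t` is Borel for the weak-* topology). -/
def IsBorelFamily (ν : I → VectorMeasure X V) : Prop :=
  ∀ B : Set X, MeasurableSet B → Measurable fun t => ν t B

/-- The condition `∫₀¹ |ν_t|(X) dt < ∞`. -/
def HasIntegrableMass (ν : I → VectorMeasure X V) : Prop :=
  Integrable (fun t => (ν t).variation.real univ) volume

theorem IsBorelFamily.measurable_section {ν : I → VectorMeasure X V} (h : IsBorelFamily ν)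
    {A : Set (I × X)} (hA : MeasurableSet A) :
    Measurable fun t => ν t (Prod.mk t ⁻¹' A) := by
  induction A, hA using MeasurableSpace.induction_on_inter generateFrom_prod.symm isPiSystem_prod
    with
  | empty => simp
  | basic A hA =>
    obtain ⟨S, hS, T, hT, rfl⟩ := hA
    have : (fun t => ν t (Prod.mk t ⁻¹' (S ×ˢ T))) = S.indicator fun t => ν t T := by
      ext1 t
      by_cases ht : t ∈ S <;> simp [ht]
    rw [this]
    exact (h T hT).indicator hS
  | compl A hA ih =>
    have : (fun t => ν t (Prod.mk t ⁻¹' Aᶜ)) =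
        fun t => ν t univ - ν t (Prod.mk t ⁻¹' A) := by
      ext1 t
      rw [preimage_compl, VectorMeasure.of_compl (measurable_prodMk_left hA)]
    rw [this]
    exact (h univ .univ).sub ih
  | iUnion f hd hf ih =>
    have hs : ∀ t, HasSum (fun i => ν t (Prod.mk t ⁻¹' f i)) (ν t (Prod.mk t ⁻¹' ⋃ i, f i)) := by
      intro t
      rw [preimage_iUnion]
      exact (ν t).m_iUnion (fun i => measurable_prodMk_left (hf i))
        fun i j hij => (hd hij).preimage _
    refine measurable_of_tendsto_metrizable (f := fun n t => ∑ i ∈ Finset.range n,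
      ν t (Prod.mk t ⁻¹' f i)) (fun n => Finset.measurable_fun_sum _ fun i _ => ih i) ?_
    rw [tendsto_pi_nhds]
    exact fun t => (hs t).tendsto_sum_nat

open scoped Classical in
/-- The space-time measure `∫₀¹ δ_t ⊗ ν_t dt` on `[0,1] × X`, given by
`A ↦ ∫₀¹ ν_t({x | (t,x) ∈ A}) dt`. It is set to `0` if the family is not Borel with integrable
mass; this value is never used for solutions of the continuity equation. -/
def spaceTimeMeasure (ν : I → VectorMeasure X V) : VectorMeasure (I × X) V :=
  if h : IsBorelFamily ν ∧ HasIntegrableMass ν then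
    { measureOf' := fun A => if MeasurableSet A then ∫ t : I, ν t (Prod.mk t ⁻¹' A) else 0
      empty' := by simp
      not_measurable' := fun A hA => by simp [hA]
      m_iUnion' := fun f hf hd => by
        simp only [hf, MeasurableSet.iUnion hf, if_true]
        have hsec : ∀ i (t : I), MeasurableSet (Prod.mk t ⁻¹' f i) :=
          fun i t => measurable_prodMk_left (hf i)
        have hdsec : ∀ t : I, Pairwise (Function.onFun Disjoint fun i => Prod.mk t ⁻¹' f i) :=
          fun t i j hij => (hd hij).preimage _
        have hbd : ∀ (t : I) (B : Set X), ‖ν t B‖ ≤ (ν t).variation.real univ := fun t B =>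
          (VectorMeasure.norm_measure_le_variation (μ := ν t) (E := B)
            (measure_ne_top _ _)).trans (measureReal_mono (subset_univ B))
        have hint : ∀ i, Integrable (fun t : I => ν t (Prod.mk t ⁻¹' f i)) volume := fun i =>
          h.2.mono' (h.1.measurable_section (hf i)).aestronglyMeasurable
            (Eventually.of_forall fun t => hbd t _)
        have hfin : ∀ (s : Finset ℕ) (t : I),
            ∑ i ∈ s, ν t (Prod.mk t ⁻¹' f i) = ν t (⋃ i ∈ s, Prod.mk t ⁻¹' f i) := fun s t =>
          (VectorMeasure.of_biUnion_finset (fun i _ j _ hij => hdsec t hij)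
            fun i _ => hsec i t).symm
        have key : Tendsto (fun s : Finset ℕ => ∫ t : I, ∑ i ∈ s, ν t (Prod.mk t ⁻¹' f i)) atTop
            (𝓝 (∫ t : I, ν t (Prod.mk t ⁻¹' ⋃ i, f i))) := by
          refine tendsto_integral_filter_of_dominated_convergence
            (fun t => (ν t).variation.real univ) ?_ ?_ h.2 ?_
          · exact Eventually.of_forall fun s =>
              (Finset.measurable_fun_sum s fun i _ =>
                h.1.measurable_section (hf i)).aestronglyMeasurable
          · refine Eventually.of_forall fun s => Eventually.of_forall fun t => ?_
            rw [hfin s t]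
            exact hbd t _
          · refine Eventually.of_forall fun t => ?_
            rw [preimage_iUnion]
            exact (ν t).m_iUnion (fun i => hsec i t) (hdsec t)
        have heq : (fun s : Finset ℕ => ∫ t : I, ∑ i ∈ s, ν t (Prod.mk t ⁻¹' f i)) =
            fun s => ∑ i ∈ s, ∫ t : I, ν t (Prod.mk t ⁻¹' f i) := by
          ext1 s
          exact integral_finsetSum s fun i _ => hint i
        rw [heq] at key
        exact key }
  else 0

end SpaceTime

/-! ### The action functional -/

section Action

variable {X : Type*} [MeasurableSpace X] {d : ℕ}

/-- The `i`-th coordinate of an `ℝ^d`-valued measure. -/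
def coordMeasure (ν : VectorMeasure X (EuclideanSpace ℝ (Fin d))) (i : Fin d) : SignedMeasure X :=
  ν.mapRange (EuclideanSpace.proj (𝕜 := ℝ) i).toLinearMap.toAddMonoidHom
    (EuclideanSpace.proj (𝕜 := ℝ) i).continuous

/-- The density of (the absolutely continuous part of) an `ℝ^d`-valued measure `ν` with respect to
a positive measure `m`, computed coordinatewise. -/
def vectorDensity (ν : VectorMeasure X (EuclideanSpace ℝ (Fin d))) (m : Measure X) (x : X) :
    EuclideanSpace ℝ (Fin d) :=
  WithLp.toLp 2 fun i => (coordMeasure ν i).rnDeriv m x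

/-- The singular part `ν^⊥ = ν - w m` of an `ℝ^d`-valued measure, `w` its density. -/
def vectorSingularPart (ν : VectorMeasure X (EuclideanSpace ℝ (Fin d))) (m : Measure X) :
    VectorMeasure X (EuclideanSpace ℝ (Fin d)) :=
  ν - m.withDensityᵥ (vectorDensity ν m)

open scoped Classical in
/-- The function `φ(u, w)` for `u ≥ 0`: `|w|² / u` for `u > 0`, and for `u = 0` it is `0` or `∞`
according to whether `w = 0` or not. -/
def phi (u : ℝ) (w : EuclideanSpace ℝ (Fin d)) : ℝ≥0∞ :=
  if 0 < u then ENNReal.ofReal (‖w‖ ^ 2 / u) else if w = 0 then 0 else ∞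

/-- A positive measure, `μ^⊥ + |ν^⊥|`, with respect to which the singular parts of `μ` and `ν` are
absolutely continuous. -/
def singularReference (m μ : Measure X) (ν : VectorMeasure X (EuclideanSpace ℝ (Fin d))) :
    Measure X :=
  μ.singularPart m + (vectorSingularPart ν m).variation

/-- The Benamou–Brenier functional `∫ φ(u,w) dm + ∫ φ(u^⊥,w^⊥) dm^⊥`. -/
def actionBB (m μ : Measure X) (ν : VectorMeasure X (EuclideanSpace ℝ (Fin d))) : ℝ≥0∞ :=
  (∫⁻ x, phi (μ.rnDeriv m x).toReal (vectorDensity ν m x) ∂m) +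
    ∫⁻ x, phi ((μ.singularPart m).rnDeriv (singularReference m μ ν) x).toReal
        (vectorDensity (vectorSingularPart ν m) (singularReference m μ ν) x)
      ∂(singularReference m μ ν)

open scoped Classical in
/-- The source functional: `∫ z² dm` if `ζ = z m`, and `∞` if `ζ` has a singular part. -/
def actionZ (m : Measure X) (ζ : SignedMeasure X) : ℝ≥0∞ :=
  if ζ.singularPart m = 0 then ∫⁻ x, ENNReal.ofReal ((ζ.rnDeriv m x) ^ 2) ∂m else ∞

/-- The action `𝒟(μ, ν, ζ)` with penalty parameter `δ` and reference measure `m`. -/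
def action (δ : ℝ) (m μ : Measure X) (ν : VectorMeasure X (EuclideanSpace ℝ (Fin d)))
    (ζ : SignedMeasure X) : ℝ≥0∞ :=
  actionBB m μ ν + ENNReal.ofReal (1 / δ) * actionZ m ζ

end Action

/-! ### The modified continuity equation -/

section ContinuityEquation

variable {d : ℕ}

/-- Lebesgue measure on a subset `K` of `ℝ^d`, as a measure on the subtype. -/
def lebesgueOn (K : Set (EuclideanSpace ℝ (Fin d))) : Measure K :=
  Measure.comap Subtype.val volume

/-- Space-time test functions: `C¹` functions `η(t,x)` on `ℝ × ℝ^d` with compact support contained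
in `(0,1) × ℝ^d`. (Their restrictions are the test functions on `(0,1) × K`.) -/
structure IsTestFunction (η : ℝ × EuclideanSpace ℝ (Fin d) → ℝ) : Prop where
  contDiff : ContDiff ℝ 1 η
  hasCompactSupport : HasCompactSupport η
  tsupport_subset : tsupport η ⊆ Ioo (0 : ℝ) 1 ×ˢ univ

/-- The triple `(μ_t, ν_t, ζ_t)_{t ∈ [0,1]}` of measures on `K` satisfies the modified continuity
equation `∂_t μ + div ν = ζ`. -/
structure ContinuityEquation (K : Set (EuclideanSpace ℝ (Fin d)))
    (μ : I → FiniteMeasure K) (ν : I → VectorMeasure K (EuclideanSpace ℝ (Fin d)))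
    (ζ : I → SignedMeasure K) : Prop where
  continuous_mass : Continuous μ
  borel_flux : IsBorelFamily ν
  borel_source : IsBorelFamily ζ
  integrable_flux : HasIntegrableMass ν
  integrable_source : HasIntegrableMass ζ
  equation : ∀ η : ℝ × EuclideanSpace ℝ (Fin d) → ℝ, IsTestFunction η →
    (∫ t : I, ∫ x : K, deriv (fun s : ℝ => η (s, x)) t ∂(μ t : Measure K)) +
      (∫ t : I, pairing (fun x : K => gradient (fun y => η (t, y)) (x : EuclideanSpace ℝ (Fin d)))
        (ν t)) +
      (∫ t : I, pairing (fun x : K => η (t, x)) (ζ t)) = 0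

/-- The total action `∫₀¹ 𝒟(μ_t, ν_t, ζ_t) dt`, with Lebesgue measure on `K` as reference. -/
def totalAction (δ : ℝ) {K : Set (EuclideanSpace ℝ (Fin d))}
    (μ : I → FiniteMeasure K) (ν : I → VectorMeasure K (EuclideanSpace ℝ (Fin d)))
    (ζ : I → SignedMeasure K) : ℝ≥0∞ :=
  ∫⁻ t : I, action δ (lebesgueOn K) (μ t : Measure K) (ν t) (ζ t)

end ContinuityEquation

end

/-!
The proof rests on duality. By Young's inequality `⟪f, w⟫ - u |f|² / 4 ≤ φ(u, w)`, the action at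
each time dominates the affine minorants `∫ f · dν - ∫ |f|² dμ / 4 + (∫ g dζ - ∫ g² dx / 4) / δ`
(`ofReal_pairing_sub_le_action`), and after integration in time the total action dominates the
space-time minorants (`ContinuityEquation.ofReal_totalPairing_sub_le`). Conversely, if `ν = w μ`
and `ζ = z dx`, the action is at most `∫ |w|² dμ + ∫ z² dx / δ` (`totalAction_densityFamily_le`).
These two one-sided bounds are all that is used about the action.

*Compactness in time.* Testing the equation with `a(t) f(x)` shows that `t ↦ ∫ f dμ_t` has the
weak derivative `∫ ∇f · dν_t + ∫ f dζ_t`. Applying the minorants to the multiples `c ∇f`, `c δ f`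
bounds its increments by `A / c + c C |t - s|` for every `c > 0`, where `A` bounds the action
(`ContinuityEquation.abs_integral_sub_le`). A cutoff in place of `f` bounds the masses uniformly,
and the optimal `c` gives a Hölder estimate of exponent `1/2`, uniform along the sequence. The
minorants also bound the fluxes and sources as functionals on continuous fields. A diagonal
extraction over countable dense sets then yields convergence of `μ_t` for every `t` to a weakly
continuous limit, and convergence of all pairings with `ν` and `ζ` (`exists_subseq_tendsto`).

*Identification of the limit.* The affine bounds pass to the limit: the limit functionals `N`, `Z`
satisfy `N F - ∫ |F|² dρ / 4 + (Z G - ∫ G² dρ' / 4) / δ ≤ liminf`, where `ρ` and `ρ'` are the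
space-time measures of the limit masses and of Lebesgue measure. Hence `N` and `Z` extend to
`L²(ρ)` and `L²(ρ')`, and the Fréchet–Riesz theorem provides densities `w`, `z`
(`exists_L2_representation`), so that the limit flux and source are `w(t, ·) μ_t` and
`z(t, ·) dx`, with no need for a disintegration of vector measures. Letting `F` and `G` approach `2 w` and
`2 z` in `L²` turns the limiting inequality into `∫ |w|² dρ + ∫ z² dρ' / δ ≤ liminf`
(`norm_sq_add_norm_sq_le_of_forall`), which is the lower semicontinuity of the action.
-/

/-! ### Pairings of vector measures with bounded fields -/

section Pairing

variable {X : Type*} [MeasurableSpace X]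
variable {V : Type*} [NormedAddCommGroup V]

/-- Induction principle for bounded strongly measurable functions: a property that holds for
constant multiples of indicators and is stable under sums and bounded pointwise limits. -/
theorem bounded_stronglyMeasurable_induction {P : (X → V) → Prop}
    (hind : ∀ (c : V) (s : Set X), MeasurableSet s → P (s.indicator fun _ => c))
    (hadd : ∀ f g : X → V, StronglyMeasurable f → StronglyMeasurable g →
      (∃ C, ∀ x, ‖f x‖ ≤ C) → (∃ C, ∀ x, ‖g x‖ ≤ C) → P f → P g → P (f + g))
    (hlim : ∀ (F : ℕ → X → V) (f : X → V) (C : ℝ), (∀ n, StronglyMeasurable (F n)) →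
      StronglyMeasurable f → (∀ n x, ‖F n x‖ ≤ C) → (∀ x, ‖f x‖ ≤ C) →
      (∀ x, Tendsto (fun n => F n x) atTop (𝓝 (f x))) → (∀ n, P (F n)) → P f)
    [NormedSpace ℝ V] {f : X → V} (hf : StronglyMeasurable f) (hb : ∃ C, ∀ x, ‖f x‖ ≤ C) : P f := by
  obtain ⟨C, hC⟩ := hb
  rcases isEmpty_or_nonempty X with hX | ⟨⟨x₀⟩⟩
  · have : f = (∅ : Set X).indicator fun _ => 0 := by ext x; exact hX.elim x
    rw [this]; exact hind 0 ∅ .empty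
  have hC0 : 0 ≤ C := (norm_nonneg _).trans (hC x₀)
  have hs : ∀ g : SimpleFunc X V, P g := by
    intro g
    induction g using SimpleFunc.induction with
    | const c hs =>
      convert hind c _ hs using 1
      ext x
      simp [Set.indicator, Set.piecewise]
    | add _ hf' hg' =>
      rename_i f' g' _
      exact hadd f' g' f'.stronglyMeasurable g'.stronglyMeasurable
        f'.exists_forall_norm_le g'.exists_forall_norm_le hf' hg'
  exact hlim (fun n => hf.approxBounded C n) f C (fun n => SimpleFunc.stronglyMeasurable _) hf
    (fun n x => hf.norm_approxBounded_le hC0 n x) hC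
    (fun x => hf.tendsto_approxBounded_of_norm_le (hC x)) fun n => hs _

variable [InnerProductSpace ℝ V]

theorem integrable_inner_of_bounded {a : Measure X} {f w : X → V} (hf : StronglyMeasurable f)
    (hb : ∃ C, ∀ x, ‖f x‖ ≤ C) (hw : Integrable w a) :
    Integrable (fun x => inner ℝ (f x) (w x)) a := by
  obtain ⟨C, hC⟩ := hb
  refine (hw.norm.const_mul C).mono' (hf.aestronglyMeasurable.inner hw.1)
    (Eventually.of_forall fun x => (norm_inner_le_norm _ _).trans ?_)
  gcongr
  exact hC x

theorem pairing_smul (ν : VectorMeasure X V) (c : ℝ) (f : X → V) :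
    pairing (c • f) ν = c * pairing f ν :=
  VectorMeasure.integral_smul f ν _ c

variable [FiniteDimensional ℝ V]

theorem integrable_variation_of_bounded (ν : VectorMeasure X V) {f : X → V}
    (hf : StronglyMeasurable f) (hb : ∃ C, ∀ x, ‖f x‖ ≤ C) : ν.Integrable f := by
  obtain ⟨C, hC⟩ := hb
  exact Integrable.of_bound (μ := ν.variation) hf.aestronglyMeasurable C (Eventually.of_forall hC)

theorem pairing_indicator_const (ν : VectorMeasure X V) {s : Set X} (hs : MeasurableSet s) (c : V) :
    pairing (s.indicator fun _ => c) ν = inner ℝ c (ν s) := by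
  unfold pairing
  rw [VectorMeasure.integral_eq_setToFun, setToFun_indicator_const _ hs (measure_ne_top _ _)]
  rfl

theorem pairing_add (ν : VectorMeasure X V) {f g : X → V} (hf : StronglyMeasurable f)
    (hg : StronglyMeasurable g) (hfb : ∃ C, ∀ x, ‖f x‖ ≤ C) (hgb : ∃ C, ∀ x, ‖g x‖ ≤ C) :
    pairing (f + g) ν = pairing f ν + pairing g ν :=
  VectorMeasure.integral_add (integrable_variation_of_bounded ν hf hfb)
    (integrable_variation_of_bounded ν hg hgb)

theorem pairing_tendsto (ν : VectorMeasure X V) {F : ℕ → X → V} {f : X → V} {C : ℝ}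
    (hF : ∀ n, StronglyMeasurable (F n)) (hC : ∀ n x, ‖F n x‖ ≤ C)
    (hlim : ∀ x, Tendsto (fun n => F n x) atTop (𝓝 (f x))) :
    Tendsto (fun n => pairing (F n) ν) atTop (𝓝 (pairing f ν)) :=
  VectorMeasure.tendsto_integral_of_dominated_convergence (fun _ => C)
    (fun n => (hF n).aestronglyMeasurable) (integrable_const C)
    (fun n => Eventually.of_forall (hC n)) (Eventually.of_forall hlim)

theorem abs_pairing_le (ν : VectorMeasure X V) {f : X → V} {C : ℝ}
    (hC : ∀ x, ‖f x‖ ≤ C) (hC0 : 0 ≤ C) : |pairing f ν| ≤ C * ν.variation.real univ := by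
  have h := VectorMeasure.norm_integral_le_of_norm_le_const (μ := ν) (B := innerSL ℝ)
    (f := f) (Eventually.of_forall hC)
  refine h.trans ?_
  have : ‖(innerSL ℝ : V →L[ℝ] V →L[ℝ] ℝ)‖ ≤ 1 := norm_innerSL_le _
  gcongr
  nlinarith

/-- Pairing with a measure `w m`. Both sides are linear and continuous under bounded pointwise
convergence in `f`, so that indicators suffice. -/
theorem pairing_withDensity {m : Measure X} {w : X → V}
    (hw : Integrable w m) {f : X → V} (hf : StronglyMeasurable f) (hb : ∃ C, ∀ x, ‖f x‖ ≤ C) :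
    pairing f (m.withDensityᵥ w) = ∫ x, inner ℝ (f x) (w x) ∂m := by
  refine bounded_stronglyMeasurable_induction (P := fun f =>
    pairing f (m.withDensityᵥ w) = ∫ x, inner ℝ (f x) (w x) ∂m) ?_ ?_ ?_ hf hb
  · intro c s hs
    rw [pairing_indicator_const _ hs, withDensityᵥ_apply hw hs,
      ← innerSL_apply_apply ℝ c, ← (innerSL ℝ c).integral_comp_comm hw.integrableOn]
    refine (integral_indicator hs).symm.trans (integral_congr_ae (Eventually.of_forall fun x => ?_))
    by_cases hx : x ∈ s <;> simp [hx]
  · intro f g hf hg hfb hgb h1 h2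
    rw [pairing_add _ hf hg hfb hgb, h1, h2, ← integral_add
      (integrable_inner_of_bounded hf hfb hw) (integrable_inner_of_bounded hg hgb hw)]
    simp [inner_add_left]
  · intro F f C hF hf hFC hfC hlim hP
    refine tendsto_nhds_unique (pairing_tendsto _ hF hFC hlim) ?_
    simp_rw [hP]
    refine tendsto_integral_of_dominated_convergence (fun x => C * ‖w x‖)
      (fun n => (hF n).aestronglyMeasurable.inner hw.1) (hw.norm.const_mul C) (fun n =>
      Eventually.of_forall fun x => (norm_inner_le_norm _ _).trans ?_) (Eventually.of_forall
      fun x => (hlim x).inner tendsto_const_nhds)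
    gcongr
    exact hFC n x

end Pairing

section SpaceTimePairing

variable {X : Type*} [MeasurableSpace X]
variable {V : Type*} [NormedAddCommGroup V] [InnerProductSpace ℝ V] [FiniteDimensional ℝ V]

theorem HasIntegrableMass.integrable_pairing_of_measurable {ν : I → VectorMeasure X V}
    (h' : HasIntegrableMass ν) {f : I × X → V} {C : ℝ} (hC : ∀ p, ‖f p‖ ≤ C)
    (hm : Measurable fun t => pairing (fun x => f (t, x)) (ν t)) :
    Integrable (fun t => pairing (fun x => f (t, x)) (ν t)) volume := by
  refine (Integrable.const_mul h' |C|).mono' hm.aestronglyMeasurable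
    (Eventually.of_forall fun t => ?_)
  exact abs_pairing_le _ (fun x => (hC _).trans (le_abs_self C)) (abs_nonneg C)

variable [MeasurableSpace V] [BorelSpace V]

theorem spaceTimeMeasure_apply {ν : I → VectorMeasure X V} (h : IsBorelFamily ν)
    (h' : HasIntegrableMass ν) {A : Set (I × X)} (hA : MeasurableSet A) :
    spaceTimeMeasure ν A = ∫ t : I, ν t (Prod.mk t ⁻¹' A) := by
  unfold spaceTimeMeasure
  rw [dif_pos ⟨h, h'⟩]
  exact if_pos hA

/-- Measurability of `t ↦ ∫ ⟨f(t, ·), dν_t⟩` and the Fubini formula, proved together since the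
approximation of `f` needs the former in order to pass to the limit in the latter. -/
theorem IsBorelFamily.measurable_pairing_and_pairing_spaceTimeMeasure
    {ν : I → VectorMeasure X V} (h : IsBorelFamily ν) (h' : HasIntegrableMass ν) {f : I × X → V}
    (hf : StronglyMeasurable f) (hb : ∃ C, ∀ p, ‖f p‖ ≤ C) :
    Measurable (fun t => pairing (fun x => f (t, x)) (ν t)) ∧
      pairing f (spaceTimeMeasure ν) = ∫ t : I, pairing (fun x => f (t, x)) (ν t) := by
  have sec : ∀ {f : I × X → V}, StronglyMeasurable f → ∀ t,
      StronglyMeasurable fun x => f (t, x) := fun hf t => hf.comp_measurable measurable_prodMk_left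
  refine bounded_stronglyMeasurable_induction (P := fun f : I × X → V =>
    Measurable (fun t => pairing (fun x => f (t, x)) (ν t)) ∧
      pairing f (spaceTimeMeasure ν) = ∫ t : I, pairing (fun x => f (t, x)) (ν t)) ?_ ?_ ?_ hf hb
  · intro c s hs
    have e : ∀ t, pairing (fun x => s.indicator (fun _ => c) (t, x)) (ν t) =
        inner ℝ c (ν t (Prod.mk t ⁻¹' s)) := fun t =>
      pairing_indicator_const (ν t) (measurable_prodMk_left hs) c
    have hm := h.measurable_section hs
    simp_rw [e]
    refine ⟨(innerSL ℝ c).continuous.measurable.comp hm, ?_⟩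
    rw [pairing_indicator_const _ hs, spaceTimeMeasure_apply h h' hs]
    refine ((innerSL ℝ c).integral_comp_comm ?_).symm
    refine h'.mono' hm.aestronglyMeasurable (Eventually.of_forall fun t => ?_)
    exact (VectorMeasure.norm_measure_le_variation (measure_ne_top _ _)).trans
      (measureReal_mono (subset_univ _))
  · rintro f g hf hg ⟨C, hC⟩ ⟨C', hC'⟩ ⟨h1, h2⟩ ⟨h3, h4⟩
    have e : ∀ t, pairing (fun x => (f + g) (t, x)) (ν t) =
        pairing (fun x => f (t, x)) (ν t) + pairing (fun x => g (t, x)) (ν t) := fun t =>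
      pairing_add _ (sec hf t) (sec hg t) ⟨C, fun _ => hC _⟩ ⟨C', fun _ => hC' _⟩
    simp_rw [e]
    refine ⟨h1.add h3, ?_⟩
    rw [pairing_add _ hf hg ⟨C, hC⟩ ⟨C', hC'⟩, h2, h4, integral_add
      (h'.integrable_pairing_of_measurable hC h1) (h'.integrable_pairing_of_measurable hC' h3)]
  · intro F f C hF hf hFC hfC hlim hP
    have hl : ∀ t, Tendsto (fun n => pairing (fun x => F n (t, x)) (ν t)) atTop
        (𝓝 (pairing (fun x => f (t, x)) (ν t))) := fun t =>
      pairing_tendsto _ (fun n => sec (hF n) t) (fun n x => hFC n _) fun x => hlim _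
    refine ⟨measurable_of_tendsto_metrizable (fun n => (hP n).1) (tendsto_pi_nhds.2 hl), ?_⟩
    refine tendsto_nhds_unique (pairing_tendsto _ hF hFC hlim) ?_
    simp_rw [fun n => (hP n).2]
    refine tendsto_integral_of_dominated_convergence (fun t => |C| * (ν t).variation.real univ)
      (fun n => (hP n).1.aestronglyMeasurable) (Integrable.const_mul h' |C|) (fun n =>
      Eventually.of_forall fun t => ?_) (Eventually.of_forall hl)
    exact abs_pairing_le _ (fun x => (hFC n _).trans (le_abs_self C)) (abs_nonneg C)

theorem IsBorelFamily.measurable_pairing {ν : I → VectorMeasure X V} (h : IsBorelFamily ν)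
    (h' : HasIntegrableMass ν) {f : I × X → V} (hf : StronglyMeasurable f)
    (hb : ∃ C, ∀ p, ‖f p‖ ≤ C) : Measurable fun t => pairing (fun x => f (t, x)) (ν t) :=
  (h.measurable_pairing_and_pairing_spaceTimeMeasure h' hf hb).1

/-- Fubini formula for the space-time measure of a Borel family. -/
theorem IsBorelFamily.pairing_spaceTimeMeasure {ν : I → VectorMeasure X V} (h : IsBorelFamily ν)
    (h' : HasIntegrableMass ν) {f : I × X → V} (hf : StronglyMeasurable f)
    (hb : ∃ C, ∀ p, ‖f p‖ ≤ C) :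
    pairing f (spaceTimeMeasure ν) = ∫ t : I, pairing (fun x => f (t, x)) (ν t) :=
  (h.measurable_pairing_and_pairing_spaceTimeMeasure h' hf hb).2

theorem IsBorelFamily.integrable_pairing {ν : I → VectorMeasure X V} (h : IsBorelFamily ν)
    (h' : HasIntegrableMass ν) {f : I × X → V} (hf : StronglyMeasurable f)
    (hb : ∃ C, ∀ p, ‖f p‖ ≤ C) :
    Integrable (fun t => pairing (fun x => f (t, x)) (ν t)) volume :=
  let ⟨_, hC⟩ := hb
  h'.integrable_pairing_of_measurable hC (h.measurable_pairing h' hf hb)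

end SpaceTimePairing

/-! ### Affine minorants of the action, and the action of measures with densities -/

section ActionBounds

variable {X : Type*} [MeasurableSpace X] {d : ℕ}

theorem ofReal_integral_le_lintegral_ofReal {m : Measure X} {h : X → ℝ} (hh : Integrable h m) :
    ENNReal.ofReal (∫ x, h x ∂m) ≤ ∫⁻ x, ENNReal.ofReal (h x) ∂m := by
  have h1 : ∫ x, h x ∂m ≤ ∫ x, max (h x) 0 ∂m :=
    integral_mono hh hh.pos_part fun x => le_max_left _ _
  refine (ENNReal.ofReal_le_ofReal h1).trans ?_
  rw [ofReal_integral_eq_lintegral_ofReal hh.pos_part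
    (Eventually.of_forall fun x => le_max_right _ _)]
  refine lintegral_mono fun x => ?_
  rw [ENNReal.ofReal_max, ENNReal.ofReal_zero, max_eq_left zero_le]

theorem integrable_vectorDensity (ν : VectorMeasure X (EuclideanSpace ℝ (Fin d)))
    (m : Measure X) : Integrable (vectorDensity ν m) m :=
  Integrable.of_eval_piLp fun _ => SignedMeasure.integrable_rnDeriv _ _

theorem coordMeasure_apply (ν : VectorMeasure X (EuclideanSpace ℝ (Fin d))) (i : Fin d)
    (A : Set X) : coordMeasure ν i A = ν A i := rfl

theorem coordMeasure_withDensity {m : Measure X} {w : X → EuclideanSpace ℝ (Fin d)}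
    (hw : Integrable w m) (i : Fin d) :
    coordMeasure (m.withDensityᵥ w) i = m.withDensityᵥ fun x => w x i := by
  ext A hA
  rw [coordMeasure_apply, withDensityᵥ_apply hw hA,
    withDensityᵥ_apply (hw.eval_piLp i) hA,
    eval_integral_piLp hw.integrableOn.eval_piLp]

/-- Radon–Nikodym theorem for `ℝ^d`-valued measures. -/
theorem withDensity_vectorDensity_eq (ν : VectorMeasure X (EuclideanSpace ℝ (Fin d)))
    (s : Measure X) [IsFiniteMeasure s] (h : ν.variation ≪ s) :
    s.withDensityᵥ (vectorDensity ν s) = ν := by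
  ext A hA i
  have hi : coordMeasure ν i ≪ᵥ s.toENNRealVectorMeasure := by
    refine VectorMeasure.AbsolutelyContinuous.mk fun B hB h0 => ?_
    rw [Measure.toENNRealVectorMeasure_apply_measurable hB] at h0
    have : ‖ν B‖ₑ ≤ 0 := (VectorMeasure.enorm_measure_le_variation ν B).trans (h h0).le
    rw [coordMeasure_apply, enorm_eq_zero.1 (le_antisymm this bot_le)]
    rfl
  rw [← coordMeasure_apply, coordMeasure_withDensity (integrable_vectorDensity ν s),
    ← coordMeasure_apply, ← SignedMeasure.withDensityᵥ_rnDeriv_eq _ s hi]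
  rfl

/-- The pointwise Young inequality `⟪f, w⟫ - |f|² u / 4 ≤ φ(u, w)`. -/
theorem ofReal_inner_sub_le_phi {u : ℝ} (hu : 0 ≤ u) (f w : EuclideanSpace ℝ (Fin d)) :
    ENNReal.ofReal (inner ℝ f w - u * ‖f‖ ^ 2 / 4) ≤ phi u w := by
  unfold phi
  split_ifs with h h'
  · apply ENNReal.ofReal_le_ofReal
    have h1 := real_inner_le_norm f w
    have h2 : 0 ≤ (‖w‖ - u * ‖f‖ / 2) ^ 2 / u := by positivity
    have h3 : (‖w‖ - u * ‖f‖ / 2) ^ 2 / u = ‖w‖ ^ 2 / u - ‖f‖ * ‖w‖ + u * ‖f‖ ^ 2 / 4 := by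
      field_simp
      ring
    linarith
  · subst h'
    have : u = 0 := le_antisymm (not_lt.1 h) hu
    simp [this]
  · exact le_top

theorem integrable_norm_sq_of_bounded {V : Type*} [NormedAddCommGroup V] {a : Measure X}
    [IsFiniteMeasure a] {f : X → V} (hf : StronglyMeasurable f) (hb : ∃ C, ∀ x, ‖f x‖ ≤ C) :
    Integrable (fun x => ‖f x‖ ^ 2) a := by
  obtain ⟨C, hC⟩ := hb
  refine Integrable.of_bound (hf.norm.pow 2).aestronglyMeasurable (C ^ 2)
    (Eventually.of_forall fun x => ?_)
  rw [norm_pow, norm_norm]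
  gcongr
  exact hC x

/-- The integrated form of `ofReal_inner_sub_le_phi`, for a measure `a` with a density with respect
to `r`. -/
theorem ofReal_integral_inner_sub_le_lintegral_phi {r a : Measure X} [IsFiniteMeasure r]
    [IsFiniteMeasure a] (har : a ≪ r) {f w : X → EuclideanSpace ℝ (Fin d)} (hw : Integrable w r)
    (hf : StronglyMeasurable f) (hb : ∃ C, ∀ x, ‖f x‖ ≤ C) :
    ENNReal.ofReal (∫ x, inner ℝ (f x) (w x) ∂r - (∫ x, ‖f x‖ ^ 2 ∂a) / 4) ≤
      ∫⁻ x, phi (a.rnDeriv r x).toReal (w x) ∂r := by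
  have h1 : Integrable (fun x => (a.rnDeriv r x).toReal * ‖f x‖ ^ 2) r := by
    simpa using (integrable_rnDeriv_smul_iff har).2 (integrable_norm_sq_of_bounded hf hb)
  rw [← integral_rnDeriv_smul har]
  simp only [smul_eq_mul]
  rw [← integral_div, ← integral_sub (integrable_inner_of_bounded hf hb hw) (h1.div_const 4)]
  refine (ofReal_integral_le_lintegral_ofReal
    ((integrable_inner_of_bounded hf hb hw).sub (h1.div_const 4))).trans ?_
  exact lintegral_mono fun x => ofReal_inner_sub_le_phi ENNReal.toReal_nonneg _ _

theorem variation_vectorSingularPart_le_singularReference (m μ : Measure X)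
    (ν : VectorMeasure X (EuclideanSpace ℝ (Fin d))) :
    (vectorSingularPart ν m).variation ≤ singularReference m μ ν :=
  Measure.le_add_left le_rfl

theorem singularPart_le_singularReference (m μ : Measure X)
    (ν : VectorMeasure X (EuclideanSpace ℝ (Fin d))) :
    μ.singularPart m ≤ singularReference m μ ν :=
  Measure.le_add_right le_rfl

instance (m μ : Measure X) [IsFiniteMeasure μ] (ν : VectorMeasure X (EuclideanSpace ℝ (Fin d))) :
    IsFiniteMeasure (singularReference m μ ν) := by
  unfold singularReference; infer_instance

/-- The Benamou–Brenier functional dominates its affine minorants (the easy half of its dual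
representation). -/
theorem ofReal_pairing_sub_le_actionBB (m μ : Measure X) [IsFiniteMeasure m] [IsFiniteMeasure μ]
    (ν : VectorMeasure X (EuclideanSpace ℝ (Fin d))) {f : X → EuclideanSpace ℝ (Fin d)}
    (hf : StronglyMeasurable f) (hb : ∃ C, ∀ x, ‖f x‖ ≤ C) :
    ENNReal.ofReal (pairing f ν - (∫ x, ‖f x‖ ^ 2 ∂μ) / 4) ≤ actionBB m μ ν := by
  set s := singularReference m μ ν
  set a := m.withDensity (μ.rnDeriv m)
  set νs := vectorSingularPart ν m
  have hνs : s.withDensityᵥ (vectorDensity νs s) = νs := withDensity_vectorDensity_eq _ _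
    (variation_vectorSingularPart_le_singularReference m μ ν).absolutelyContinuous
  have hν : ν = m.withDensityᵥ (vectorDensity ν m) + νs := by simp [νs, vectorSingularPart]
  have h1 : pairing f ν = ∫ x, inner ℝ (f x) (vectorDensity ν m x) ∂m +
      ∫ x, inner ℝ (f x) (vectorDensity νs s x) ∂s := by
    rw [← pairing_withDensity (integrable_vectorDensity ν m) hf hb,
      ← pairing_withDensity (integrable_vectorDensity νs s) hf hb, hνs]
    conv_lhs => rw [hν]
    exact VectorMeasure.integral_add_vectorMeasure (integrable_variation_of_bounded _ hf hb)
      (integrable_variation_of_bounded _ hf hb)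
  have ha : IsFiniteMeasure a := isFiniteMeasure_of_le μ (Measure.withDensity_rnDeriv_le μ m)
  have h2 : ∫ x, ‖f x‖ ^ 2 ∂μ = ∫ x, ‖f x‖ ^ 2 ∂a + ∫ x, ‖f x‖ ^ 2 ∂(μ.singularPart m) := by
    rw [← integral_add_measure (integrable_norm_sq_of_bounded hf hb)
      (integrable_norm_sq_of_bounded hf hb), Measure.rnDeriv_add_singularPart]
  have h3 := ofReal_integral_inner_sub_le_lintegral_phi (withDensity_absolutelyContinuous m
    (μ.rnDeriv m)) (integrable_vectorDensity ν m) hf hb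
  have h4 := ofReal_integral_inner_sub_le_lintegral_phi
    (singularPart_le_singularReference m μ ν).absolutelyContinuous
    (integrable_vectorDensity νs s) hf hb
  have h5 : ∫⁻ x, phi (a.rnDeriv m x).toReal (vectorDensity ν m x) ∂m =
      ∫⁻ x, phi (μ.rnDeriv m x).toReal (vectorDensity ν m x) ∂m := by
    refine lintegral_congr_ae ?_
    filter_upwards [Measure.rnDeriv_withDensity m (Measure.measurable_rnDeriv μ m)] with x hx
    rw [hx]
  rw [h5] at h3
  refine le_trans ?_ (add_le_add h3 h4)
  refine le_trans (le_of_eq ?_) ENNReal.ofReal_add_le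
  congr 1
  rw [h1, h2]
  ring

/-- The source functional dominates its affine minorants. -/
theorem ofReal_pairing_sub_le_actionZ (m : Measure X) [IsFiniteMeasure m] (ζ : SignedMeasure X)
    {g : X → ℝ} (hg : StronglyMeasurable g) (hb : ∃ C, ∀ x, ‖g x‖ ≤ C) :
    ENNReal.ofReal (pairing g ζ - (∫ x, ‖g x‖ ^ 2 ∂m) / 4) ≤ actionZ m ζ := by
  unfold actionZ
  split_ifs with h
  swap
  · exact le_top
  have hz := SignedMeasure.integrable_rnDeriv ζ m
  have h1 : pairing g ζ = ∫ x, inner ℝ (g x) (ζ.rnDeriv m x) ∂m := by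
    rw [← pairing_withDensity hz hg hb]
    congr 1
    conv_lhs =>
      rw [← ζ.singularPart_add_withDensity_rnDeriv_eq m, h, zero_add]
  have h2 := (integrable_norm_sq_of_bounded (a := m) hg hb).div_const 4
  rw [h1, ← integral_div, ← integral_sub (integrable_inner_of_bounded hg hb hz) h2]
  refine (ofReal_integral_le_lintegral_ofReal
    ((integrable_inner_of_bounded hg hb hz).sub h2)).trans (lintegral_mono fun x => ?_)
  apply ENNReal.ofReal_le_ofReal
  simp only [RCLike.inner_apply, conj_trivial, Real.norm_eq_abs, sq_abs, Pi.sub_apply]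
  nlinarith [sq_nonneg (ζ.rnDeriv m x - g x / 2)]

/-- The action at a fixed time dominates its affine minorants. The lower bound is an ordinary
integral of bounded functions, so that it stays usable where the measurability in time of the
action is not known. -/
theorem ofReal_pairing_sub_le_action {δ : ℝ} (hδ : 0 < δ) (m μ : Measure X) [IsFiniteMeasure m]
    [IsFiniteMeasure μ] (ν : VectorMeasure X (EuclideanSpace ℝ (Fin d))) (ζ : SignedMeasure X)
    {f : X → EuclideanSpace ℝ (Fin d)} (hf : StronglyMeasurable f) (hfb : ∃ C, ∀ x, ‖f x‖ ≤ C)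
    {g : X → ℝ} (hg : StronglyMeasurable g) (hgb : ∃ C, ∀ x, ‖g x‖ ≤ C) :
    ENNReal.ofReal (pairing f ν - (∫ x, ‖f x‖ ^ 2 ∂μ) / 4 +
      1 / δ * (pairing g ζ - (∫ x, ‖g x‖ ^ 2 ∂m) / 4)) ≤ action δ m μ ν ζ := by
  refine ENNReal.ofReal_add_le.trans (add_le_add (ofReal_pairing_sub_le_actionBB m μ ν hf hfb) ?_)
  rw [ENNReal.ofReal_mul (by positivity)]
  gcongr
  exact ofReal_pairing_sub_le_actionZ m ζ hg hgb

theorem mutuallySingular_coordMeasure_withDensity {a m : Measure X} (ham : a ⟂ₘ m)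
    {w : X → EuclideanSpace ℝ (Fin d)} (hw : Integrable w a) (i : Fin d) :
    coordMeasure (a.withDensityᵥ w) i ⟂ᵥ m.toENNRealVectorMeasure := by
  obtain ⟨S, hS, h1, h2⟩ := ham
  refine ⟨S, hS, fun t ht => ?_, fun t ht => ?_⟩
  · by_cases htm : MeasurableSet t
    · rw [coordMeasure_apply, withDensityᵥ_apply hw htm,
        setIntegral_measure_zero _ (measure_mono_null ht h1)]
      rfl
    · exact VectorMeasure.not_measurable _ htm
  · by_cases htm : MeasurableSet t
    · rw [Measure.toENNRealVectorMeasure_apply_measurable htm]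
      exact measure_mono_null ht h2
    · exact VectorMeasure.not_measurable _ htm

/-- Uniqueness of the density in a Lebesgue decomposition of an `ℝ^d`-valued measure. -/
theorem vectorDensity_ae_eq {a m : Measure X} (ham : a ⟂ₘ m)
    {w g : X → EuclideanSpace ℝ (Fin d)} (hw : Integrable w a) (hg : Integrable g m) :
    vectorDensity (a.withDensityᵥ w + m.withDensityᵥ g) m =ᵐ[m] g := by
  have : ∀ i, (fun x => g x i) =ᵐ[m]
      (coordMeasure (a.withDensityᵥ w + m.withDensityᵥ g) i).rnDeriv m := fun i => by
    refine SignedMeasure.eq_rnDeriv _ _ (hg.eval_piLp i)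
      (mutuallySingular_coordMeasure_withDensity ham hw i) ?_
    refine Eq.trans ?_ (congrArg (coordMeasure (a.withDensityᵥ w) i + ·)
      (coordMeasure_withDensity hg i))
    ext A hA
    rfl
  filter_upwards [ae_all_iff.2 this] with x hx
  ext i
  exact (hx i).symm

/-- If `w` is the density of `ν` with respect to `μ` and `u` that of `μ` with respect to a reference
measure, then `u w` is that of `ν`, and `φ(u, u w) ≤ u |w|²`. -/
theorem phi_smul_le (u : ℝ≥0∞) (w : EuclideanSpace ℝ (Fin d)) :
    phi u.toReal (u.toReal • w) ≤ u * ENNReal.ofReal (‖w‖ ^ 2) := by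
  unfold phi
  split_ifs with h h'
  · have : ‖u.toReal • w‖ ^ 2 / u.toReal = u.toReal * ‖w‖ ^ 2 := by
      rw [norm_smul, Real.norm_of_nonneg h.le]
      field_simp
    rw [this, ENNReal.ofReal_mul h.le]
    gcongr
    exact ENNReal.ofReal_toReal_le
  · exact bot_le
  · have : u.toReal = 0 := le_antisymm (not_lt.1 h) ENNReal.toReal_nonneg
    exact absurd (by simp [this]) h'

/-- If `ν = w μ`, the Benamou–Brenier functional is at most `∫ |w|² dμ`. -/
theorem actionBB_withDensity_le (m μ : Measure X) [IsFiniteMeasure m] [IsFiniteMeasure μ]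
    {w : X → EuclideanSpace ℝ (Fin d)} (hw : Integrable w μ) (hwm : Measurable w) :
    actionBB m μ (μ.withDensityᵥ w) ≤ ∫⁻ x, ENNReal.ofReal (‖w x‖ ^ 2) ∂μ := by
  set a := μ.singularPart m with ha
  set ν := μ.withDensityᵥ w with hν
  have hmeas : Measurable fun x => ENNReal.ofReal (‖w x‖ ^ 2) := by fun_prop
  have hwa : Integrable w a := hw.mono_measure (Measure.singularPart_le μ m)
  have hwr : Integrable w (m.withDensity (μ.rnDeriv m)) :=
    hw.mono_measure (Measure.withDensity_rnDeriv_le μ m)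
  have hlt : ∀ᵐ x ∂m, μ.rnDeriv m x < ∞ := Measure.rnDeriv_lt_top μ m
  have hg : Integrable (fun x => (μ.rnDeriv m x).toReal • w x) m :=
    (integrable_withDensity_iff_integrable_smul' (Measure.measurable_rnDeriv μ m) hlt).1 hwr
  -- the Lebesgue decomposition of `w μ` is `w` times that of `μ`
  have hdec : ν = a.withDensityᵥ w + m.withDensityᵥ fun x => (μ.rnDeriv m x).toReal • w x := by
    rw [withDensityᵥ_smul_eq_withDensityᵥ_withDensity' (Measure.measurable_rnDeriv μ m).aemeasurable
      hlt hg]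
    ext1 A hA
    rw [_root_.add_apply, withDensityᵥ_apply hw hA, withDensityᵥ_apply hwa hA,
      withDensityᵥ_apply hwr hA, ← integral_add_measure hwa.integrableOn hwr.integrableOn,
      ← Measure.restrict_add, Measure.singularPart_add_rnDeriv]
  have hd : vectorDensity ν m =ᵐ[m] fun x => (μ.rnDeriv m x).toReal • w x := by
    rw [hdec]
    exact vectorDensity_ae_eq (Measure.mutuallySingular_singularPart μ m) hwa hg
  have hsing : vectorSingularPart ν m = a.withDensityᵥ w := by
    unfold vectorSingularPart
    rw [WithDensityᵥEq.congr_ae hd, hdec, add_sub_cancel_right]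
  set s := singularReference m μ ν
  have has : a ≪ s := (singularPart_le_singularReference m μ ν).absolutelyContinuous
  have hgs : Integrable (fun x => (a.rnDeriv s x).toReal • w x) s :=
    (integrable_rnDeriv_smul_iff has).2 hwa
  -- `ν^⊥ = w μ^⊥` is absolutely continuous with respect to `s`, so its density there is exact
  have hds : vectorDensity (vectorSingularPart ν m) s =ᵐ[s]
      fun x => (a.rnDeriv s x).toReal • w x := by
    have := vectorDensity_ae_eq (a := 0) (m := s) Measure.MutuallySingular.zero_left
      (w := 0) (integrable_zero _ _ _) hgs
    rw [withDensityᵥ_zero, zero_add, withDensityᵥ_rnDeriv_smul has hwa, ← hsing] at this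
    exact this
  have h1 : ∫⁻ x, phi (μ.rnDeriv m x).toReal (vectorDensity ν m x) ∂m ≤
      ∫⁻ x, ENNReal.ofReal (‖w x‖ ^ 2) ∂(m.withDensity (μ.rnDeriv m)) := by
    rw [lintegral_withDensity_eq_lintegral_mul _ (Measure.measurable_rnDeriv μ m) hmeas]
    refine lintegral_mono_ae ?_
    filter_upwards [hd] with x hx
    rw [hx]
    exact phi_smul_le _ _
  have h2 : ∫⁻ x, phi (a.rnDeriv s x).toReal (vectorDensity (vectorSingularPart ν m) s x) ∂s ≤
      ∫⁻ x, ENNReal.ofReal (‖w x‖ ^ 2) ∂a := by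
    conv_rhs => rw [← Measure.withDensity_rnDeriv_eq a s has]
    rw [lintegral_withDensity_eq_lintegral_mul _ (Measure.measurable_rnDeriv a s) hmeas]
    refine lintegral_mono_ae ?_
    filter_upwards [hds] with x hx
    rw [hx]
    exact phi_smul_le _ _
  refine (add_le_add h1 h2).trans (le_of_eq ?_)
  rw [← lintegral_add_measure, Measure.rnDeriv_add_singularPart]

/-- If `ζ = z m`, the source functional is at most `∫ |z|² dm`. -/
theorem actionZ_withDensity_le (m : Measure X) [IsFiniteMeasure m] {z : X → ℝ}
    (hz : Integrable z m) :
    actionZ m (m.withDensityᵥ z) ≤ ∫⁻ x, ENNReal.ofReal (‖z x‖ ^ 2) ∂m := by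
  have h0 : (0 : SignedMeasure X) ⟂ᵥ m.toENNRealVectorMeasure :=
    VectorMeasure.MutuallySingular.zero_left
  have h1 := SignedMeasure.eq_singularPart (0 : SignedMeasure X) z h0 (zero_add _).symm
  have h2 := SignedMeasure.eq_rnDeriv (0 : SignedMeasure X) z hz h0 (zero_add _).symm
  unfold actionZ
  rw [if_pos h1.symm]
  refine le_of_eq (lintegral_congr_ae ?_)
  filter_upwards [h2] with x hx
  rw [← hx, Real.norm_eq_abs, sq_abs]

end ActionBounds

/-! ### Increments of functions with a weak derivative -/

section WeakDerivative

/-- A smoothed indicator function of an interval: the difference of the primitives of two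
translates of a mollifier. -/
theorem exists_smooth_cutoff_with_deriv (φ : ContDiffBump (0 : ℝ)) {s t : ℝ} (hst : s ≤ t) :
    ∃ a : ℝ → ℝ, ContDiff ℝ 1 a ∧
      (∀ x, deriv a x = φ.normed volume (x - s) - φ.normed volume (x - t)) ∧
      (∀ x, 0 ≤ a x ∧ a x ≤ 1) ∧ Function.support a ⊆ Icc (s - φ.rOut) (t + φ.rOut) := by
  set ρ := φ.normed volume with hρ
  have hc : Continuous ρ := φ.continuous_normed
  have hi : ∀ a b, IntervalIntegrable ρ volume a b := fun a b => hc.intervalIntegrable a b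
  set Φ : ℝ → ℝ := fun x => ∫ y in (0 : ℝ)..x, ρ y
  have hΦ : ∀ x, HasDerivAt Φ (ρ x) x := fun x => hc.integral_hasStrictDerivAt 0 x |>.hasDerivAt
  set a : ℝ → ℝ := fun x => Φ (x - s) - Φ (x - t)
  have ha : ∀ x, HasDerivAt a (ρ (x - s) - ρ (x - t)) x := fun x =>
    ((hΦ (x - s)).comp_sub_const x s).sub ((hΦ (x - t)).comp_sub_const x t)
  have hai : ∀ x, a x = ∫ y in (x - t)..(x - s), ρ y := fun x =>
    intervalIntegral.integral_interval_sub_left (hi _ _) (hi _ _)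
  have hd : deriv a = fun x => ρ (x - s) - ρ (x - t) := funext fun x => (ha x).deriv
  refine ⟨a, contDiff_one_iff_deriv.2 ⟨fun x => (ha x).differentiableAt, ?_⟩,
    fun x => (ha x).deriv, fun x => ⟨?_, ?_⟩, ?_⟩
  · rw [hd]
    fun_prop
  · rw [hai]
    exact intervalIntegral.integral_nonneg (by linarith) fun y _ => φ.nonneg_normed y
  · rw [hai, intervalIntegral.integral_of_le (by linarith), ← φ.integral_normed (μ := volume)]
    exact setIntegral_le_integral φ.integrable_normed
      (Eventually.of_forall fun y => φ.nonneg_normed y)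
  · intro x hx
    by_contra hx'
    refine hx ?_
    rw [hai, intervalIntegral.integral_congr (g := fun _ => 0), intervalIntegral.integral_zero]
    intro y hy
    rw [uIcc_of_le (by linarith)] at hy
    have : y ∉ Function.support ρ := by
      rw [φ.support_normed_eq, Metric.mem_ball, dist_zero_right, Real.norm_eq_abs, not_lt, le_abs]
      rw [mem_Icc, not_and_or, not_le, not_le] at hx'
      obtain ⟨hy1, hy2⟩ := hy
      rcases hx' with h | h
      · right; linarith
      · left; linarith
    simpa using this

/-- Averages against translated mollifiers shrinking to `s` converge to the value at `s`. -/
theorem integral_normed_sub_mul_tendsto {H : ℝ → ℝ} (hH : Continuous H)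
    {φ : ℕ → ContDiffBump (0 : ℝ)} (hφ : Tendsto (fun n => (φ n).rOut) atTop (𝓝 0)) (s : ℝ) :
    Tendsto (fun n => ∫ x, (φ n).normed volume (x - s) * H x) atTop (𝓝 (H s)) := by
  refine (ContDiffBump.convolution_tendsto_right_of_continuous (μ := volume) hφ hH s).congr
    fun n => ?_
  unfold convolution
  rw [← integral_sub_left_eq_self _ volume s]
  refine integral_congr_ae (Eventually.of_forall fun x => ?_)
  simp only [ContinuousLinearMap.lsmul_apply, smul_eq_mul, sub_sub_cancel]
  rw [← neg_sub, ContDiffBump.normed_neg]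

theorem integral_normed_sub_mul_eq (φ : ContDiffBump (0 : ℝ)) {s : ℝ} (h0 : φ.rOut < s)
    (h1 : s + φ.rOut < 1) (H : ℝ → ℝ) :
    ∫ t : I, φ.normed volume (t - s) * H t = ∫ x, φ.normed volume (x - s) * H x := by
  rw [integral_subtype measurableSet_Icc fun x : ℝ => φ.normed volume (x - s) * H x]
  refine setIntegral_eq_integral_of_forall_compl_eq_zero fun x hx => ?_
  have : x - s ∉ Function.support (φ.normed volume) := by
    rw [φ.support_normed_eq, Metric.mem_ball, dist_zero_right, Real.norm_eq_abs, not_lt, le_abs]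
    rw [mem_Icc, not_and_or, not_le, not_le] at hx
    rcases hx with h | h
    · right; linarith
    · left; linarith
  simp only [Function.mem_support, not_not] at this
  rw [this, zero_mul]

/-- `g` is the distributional derivative of `h` on `(0, 1)`. -/
def IsWeakDerivative (h g : I → ℝ) : Prop :=
  ∀ a : ℝ → ℝ, ContDiff ℝ 1 a → HasCompactSupport a → tsupport a ⊆ Ioo 0 1 →
    (∫ t : I, deriv a t * h t) + ∫ t : I, a t * g t = 0

/-- The increment bound between interior times: test the weak derivative with smoothed indicators of
`[s, t]` whose supports stay inside `(0, 1)`, then let the smoothing parameter tend to `0`. -/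
theorem IsWeakDerivative.sub_le_of_interior {h g : I → ℝ} (hw : IsWeakDerivative h g)
    {H : ℝ → ℝ} (hH : Continuous H) (hHh : ∀ t : I, H t = h t) (hg : Integrable g)
    {A C : ℝ} (hC : 0 ≤ C) (hA : ∫⁻ t, ENNReal.ofReal (g t - C) ≤ ENNReal.ofReal A) (hA0 : 0 ≤ A)
    {s t : ℝ} (hs : 0 < s) (hst : s ≤ t) (ht : t < 1) : H t - H s ≤ A + C * (t - s) := by
  set r : ℝ := min s (1 - t)
  have hr : 0 < r := lt_min hs (by linarith)
  set φ : ℕ → ContDiffBump (0 : ℝ) := fun n =>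
    ⟨r / (2 * (n + 2)), r / (n + 2), by positivity, by
      apply div_lt_div_of_pos_left hr (by positivity)
      have : (0 : ℝ) ≤ n := n.cast_nonneg
      linarith⟩
  have hφr : ∀ n, (φ n).rOut < r := fun n => by
    have : (0 : ℝ) ≤ n := n.cast_nonneg
    exact div_lt_self hr (by linarith)
  have hφ : Tendsto (fun n => (φ n).rOut) atTop (𝓝 0) :=
    Tendsto.div_atTop tendsto_const_nhds
      (tendsto_atTop_add_const_right _ _ tendsto_natCast_atTop_atTop)
  have key : ∀ n, (∫ x, (φ n).normed volume (x - t) * H x) -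
      ∫ x, (φ n).normed volume (x - s) * H x ≤ A + C * (t - s + 2 * (φ n).rOut) := by
    intro n
    have hrs : r ≤ s := min_le_left _ _
    have hrt : r ≤ 1 - t := min_le_right _ _
    have hn := hφr n
    have hn0 := (φ n).rOut_pos
    obtain ⟨a, ha1, had, ha01, hsupp⟩ := exists_smooth_cutoff_with_deriv (φ n) hst
    have hts : tsupport a ⊆ Icc (s - (φ n).rOut) (t + (φ n).rOut) :=
      closure_minimal hsupp isClosed_Icc
    have hcs : HasCompactSupport a := isCompact_Icc.of_isClosed_subset (isClosed_tsupport a) hts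
    have e := hw a ha1 hcs (hts.trans fun x hx => ⟨by linarith [hx.1], by linarith [hx.2]⟩)
    have hint : ∀ s : ℝ, Integrable (fun t : I => (φ n).normed volume (t - s) * H t) := fun s =>
      (Continuous.mul ((φ n).continuous_normed.comp (by fun_prop))
        (hH.comp continuous_subtype_val)).integrable_of_hasCompactSupport
        (HasCompactSupport.of_compactSpace _)
    have e1 : ∫ t : I, deriv a t * h t = (∫ x, (φ n).normed volume (x - s) * H x) -
        ∫ x, (φ n).normed volume (x - t) * H x := by
      rw [← integral_normed_sub_mul_eq (φ n) (by linarith) (by linarith),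
        ← integral_normed_sub_mul_eq (φ n) (by linarith) (by linarith),
        ← integral_sub (hint s) (hint t)]
      refine integral_congr_ae (Eventually.of_forall fun x => ?_)
      simp only [had, ← hHh]
      ring
    have hac : Continuous fun t : I => a t := ha1.continuous.comp continuous_subtype_val
    have hai : Integrable fun t : I => a t :=
      hac.integrable_of_hasCompactSupport (HasCompactSupport.of_compactSpace _)
    have hag : Integrable fun t : I => a t * g t :=
      hg.bdd_mul hac.aestronglyMeasurable (c := 1) (Eventually.of_forall fun x => by
        rw [Real.norm_of_nonneg (ha01 _).1]; exact (ha01 _).2)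
    have hgC : Integrable fun t : I => g t - C := hg.sub (integrable_const C)
    have h1 : ∫ t : I, a t * g t ≤ ∫ t : I, (max (g t - C) 0 + C * a t) := by
      refine integral_mono hag (hgC.pos_part.add (hai.const_mul C)) fun x => ?_
      have := ha01 x
      have h3 := le_max_left (g x - C) 0
      have h4 := le_max_right (g x - C) 0
      simp only
      nlinarith
    have h2 : ∫ t : I, max (g t - C) 0 ≤ A := by
      rw [integral_eq_lintegral_of_nonneg_ae (f := fun t : I => max (g t - C) 0)
        (Eventually.of_forall fun x => le_max_right _ _) hgC.pos_part.aestronglyMeasurable]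
      refine ENNReal.toReal_le_of_le_ofReal hA0 (le_trans (lintegral_mono fun x => ?_) hA)
      rw [ENNReal.ofReal_max, ENNReal.ofReal_zero, max_eq_left zero_le]
    have h3 : ∫ t : I, a t ≤ t - s + 2 * (φ n).rOut := by
      rw [integral_subtype measurableSet_Icc a]
      have hai' : Integrable a := ha1.continuous.integrable_of_hasCompactSupport hcs
      calc ∫ x in Icc 0 1, a x ≤ ∫ x, a x :=
            setIntegral_le_integral hai' (Eventually.of_forall fun x => (ha01 x).1)
        _ = ∫ x in Icc (s - (φ n).rOut) (t + (φ n).rOut), a x :=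
            (setIntegral_eq_integral_of_forall_compl_eq_zero fun x hx => by
              by_contra h; exact hx (hsupp h)).symm
        _ ≤ ∫ x in Icc (s - (φ n).rOut) (t + (φ n).rOut), 1 :=
            integral_mono hai'.integrableOn (by simp) fun x => (ha01 x).2
        _ = t - s + 2 * (φ n).rOut := by
            simp only [integral_const, smul_eq_mul, mul_one, measureReal_restrict_apply_univ,
              Real.volume_real_Icc]
            rw [max_eq_left (by linarith)]
            ring
    rw [integral_add hgC.pos_part (hai.const_mul C), integral_const_mul] at h1
    have h4 := mul_le_mul_of_nonneg_left h3 hC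
    linarith
  have hl := (integral_normed_sub_mul_tendsto hH hφ t).sub
    (integral_normed_sub_mul_tendsto hH hφ s)
  have hr' : Tendsto (fun n => A + C * (t - s + 2 * (φ n).rOut)) atTop
      (𝓝 (A + C * (t - s + 2 * 0))) :=
    ((tendsto_const_nhds.add (hφ.const_mul 2)).const_mul C).const_add A
  simpa using le_of_tendsto_of_tendsto' hl hr' key

/-- One-sided increment bound from an integral bound on the positive part of the weak derivative. -/
theorem IsWeakDerivative.sub_le {h g : I → ℝ} (hw : IsWeakDerivative h g)
    (hh : Continuous h) (hg : Integrable g) {A C : ℝ} (hC : 0 ≤ C)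
    (hA : ∫⁻ t, ENNReal.ofReal (g t - C) ≤ ENNReal.ofReal A) (hA0 : 0 ≤ A)
    {s t : I} (hst : s ≤ t) : h t - h s ≤ A + C * ((t : ℝ) - s) := by
  set H : ℝ → ℝ := IccExtend zero_le_one h
  have hH : Continuous H := hh.Icc_extend'
  have hHh : ∀ t : I, H t = h t := fun t => IccExtend_val zero_le_one h t
  -- the interior estimate, applied after contracting `[0, 1]` towards its midpoint
  set c : ℝ → ℝ → ℝ := fun x θ => (1 - θ) * x + θ / 2
  have hc : ∀ x, Tendsto (c x) (𝓝[>] 0) (𝓝 x) := fun x => by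
    have : Continuous (c x) := by fun_prop
    have h := this.tendsto 0
    simp only [c, sub_zero, one_mul, zero_div, add_zero] at h
    exact h.mono_left nhdsWithin_le_nhds
  have hl := ((hH.tendsto _).comp (hc t)).sub ((hH.tendsto _).comp (hc s))
  have hr := (((hc t).sub (hc s)).const_mul C).const_add A
  rw [← hHh, ← hHh]
  refine le_of_tendsto_of_tendsto hl hr ?_
  filter_upwards [Ioo_mem_nhdsGT (zero_lt_one' ℝ)] with θ hθ
  have h1 := s.2.1
  have h2 := t.2.2
  have h3 : (s : ℝ) ≤ t := hst
  obtain ⟨h4, h5⟩ := hθ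
  exact hw.sub_le_of_interior hH hHh hg hC hA hA0 (by simp only [c]; nlinarith)
    (by simp only [c]; nlinarith) (by simp only [c]; nlinarith)

end WeakDerivative

/-! ### Time increments along solutions of the continuity equation -/

section Increments

variable {d : ℕ} {K : Set (EuclideanSpace ℝ (Fin d))}

theorem isFiniteMeasure_lebesgueOn (hK : IsCompact K) : IsFiniteMeasure (lebesgueOn K) := by
  refine ⟨?_⟩
  unfold lebesgueOn
  rw [comap_subtype_coe_apply hK.measurableSet, image_univ, Subtype.range_coe]
  exact hK.measure_lt_top

theorem continuous_gradient_of_contDiff {f : EuclideanSpace ℝ (Fin d) → ℝ} (hf : ContDiff ℝ 1 f) :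
    Continuous (gradient f) :=
  (InnerProductSpace.toDual ℝ _).symm.continuous.comp (hf.continuous_fderiv one_ne_zero)

theorem exists_gradient_norm_le {f : EuclideanSpace ℝ (Fin d) → ℝ} (hf : ContDiff ℝ 1 f)
    (hfc : HasCompactSupport f) : ∃ C, ∀ x, ‖gradient f x‖ ≤ C := by
  refine (continuous_gradient_of_contDiff hf).bounded_above_of_compact_support ?_
  refine (hfc.fderiv ℝ).mono fun x hx => ?_
  contrapose! hx
  simp only [Function.mem_support, not_not] at hx ⊢
  simp [gradient, hx]

theorem isTestFunction_mul {a : ℝ → ℝ} (ha : ContDiff ℝ 1 a) (hac : HasCompactSupport a)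
    (has : tsupport a ⊆ Ioo 0 1) {f : EuclideanSpace ℝ (Fin d) → ℝ} (hf : ContDiff ℝ 1 f)
    (hfc : HasCompactSupport f) :
    IsTestFunction fun p : ℝ × EuclideanSpace ℝ (Fin d) => a p.1 * f p.2 := by
  have hsub : tsupport (fun p : ℝ × EuclideanSpace ℝ (Fin d) => a p.1 * f p.2) ⊆
      tsupport a ×ˢ tsupport f := by
    refine closure_minimal (fun p hp => ?_) ((isClosed_tsupport a).prod (isClosed_tsupport f))
    exact ⟨subset_tsupport a (left_ne_zero_of_mul hp), subset_tsupport f (right_ne_zero_of_mul hp)⟩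
  refine ⟨(ha.comp contDiff_fst).mul (hf.comp contDiff_snd), ?_, ?_⟩
  · exact (hac.isCompact.prod hfc.isCompact).of_isClosed_subset (isClosed_tsupport _) hsub
  · exact hsub.trans (prod_mono has (subset_univ _))

theorem gradient_const_mul_of_contDiff (c : ℝ) {f : EuclideanSpace ℝ (Fin d) → ℝ}
    (hf : ContDiff ℝ 1 f) (x : EuclideanSpace ℝ (Fin d)) :
    gradient (fun y => c * f y) x = c • gradient f x := by
  unfold gradient
  rw [fderiv_const_mul (hf.differentiable one_ne_zero x)]
  simp

variable {μ : I → FiniteMeasure K} {ν : I → VectorMeasure K (EuclideanSpace ℝ (Fin d))}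
  {ζ : I → SignedMeasure K}

theorem ContinuityEquation.integrable_weakDerivative (h : ContinuityEquation K μ ν ζ)
    {f : EuclideanSpace ℝ (Fin d) → ℝ} (hf : ContDiff ℝ 1 f) (hfc : HasCompactSupport f) :
    Integrable (fun t => pairing (fun x : K => gradient f x) (ν t)) ∧
      Integrable fun t => pairing (fun x : K => f x) (ζ t) := by
  obtain ⟨C, hC⟩ := exists_gradient_norm_le hf hfc
  obtain ⟨B, hB⟩ := hf.continuous.bounded_above_of_compact_support hfc
  have hgc := continuous_gradient_of_contDiff hf
  exact ⟨h.borel_flux.integrable_pairing h.integrable_flux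
      (f := fun p : I × K => gradient f p.2)
      (hgc.comp (continuous_subtype_val.comp continuous_snd)).stronglyMeasurable
      ⟨C, fun p => hC _⟩,
    h.borel_source.integrable_pairing h.integrable_source (f := fun p : I × K => f p.2)
      (hf.continuous.comp (continuous_subtype_val.comp continuous_snd)).stronglyMeasurable
      ⟨B, fun p => hB _⟩⟩

/-- The continuity equation tested with products `a(t) f(x)`: the function `t ↦ ∫ f dμ_t` has the
weak derivative `∫ ∇f · dν_t + ∫ f dζ_t`. -/
theorem ContinuityEquation.isWeakDerivative (h : ContinuityEquation K μ ν ζ)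
    {f : EuclideanSpace ℝ (Fin d) → ℝ} (hf : ContDiff ℝ 1 f) (hfc : HasCompactSupport f) :
    IsWeakDerivative (fun t => ∫ x : K, f x ∂(μ t : Measure K))
      fun t => pairing (fun x : K => gradient f x) (ν t) + pairing (fun x : K => f x) (ζ t) := by
  intro a ha hac has
  obtain ⟨h1, h2⟩ := h.integrable_weakDerivative hf hfc
  have e := h.equation _ (isTestFunction_mul ha hac has hf hfc)
  obtain ⟨c, hc⟩ := ha.continuous.bounded_above_of_compact_support hac
  have hb : ∀ {g : I → ℝ}, Integrable g → Integrable fun t : I => a t * g t := fun hg =>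
    hg.bdd_mul (ha.continuous.comp continuous_subtype_val).aestronglyMeasurable
      (Eventually.of_forall fun t => hc t)
  have e1 : ∀ (t : I) (x : K), deriv (fun s : ℝ => a s * f x) t = deriv a t * f x := fun t x =>
    deriv_mul_const (ha.differentiable one_ne_zero _) _
  have e2 : ∀ t : I, pairing (fun x : K => gradient (fun y => a t * f y)
      (x : EuclideanSpace ℝ (Fin d))) (ν t) = a t * pairing (fun x : K => gradient f x) (ν t) := by
    intro t
    rw [← pairing_smul]
    congr 1
    ext1 x
    exact gradient_const_mul_of_contDiff _ hf _
  have e3 : ∀ t : I, pairing (fun x : K => a t * f x) (ζ t) =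
      a t * pairing (fun x : K => f x) (ζ t) := fun t => pairing_smul (ζ t) (a t) _
  simp only [e1, e2, e3, integral_const_mul] at e
  simp only [mul_add]
  rw [integral_add (hb h1) (hb h2), ← add_assoc]
  exact e

theorem IsWeakDerivative.const_mul {h g : I → ℝ} (hw : IsWeakDerivative h g) (c : ℝ) :
    IsWeakDerivative (fun t => c * h t) fun t => c * g t := by
  intro a ha hac has
  have := congrArg (c * ·) (hw a ha hac has)
  simp only [mul_zero, mul_add, ← integral_const_mul] at this
  rw [← this]
  congr 2 <;> ext t <;> ring

theorem ContinuityEquation.continuous_integral (h : ContinuityEquation K μ ν ζ) (hK : IsCompact K)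
    {f : K → ℝ} (hf : Continuous f) : Continuous fun t => ∫ x, f x ∂(μ t : Measure K) := by
  have := isCompact_iff_compactSpace.1 hK
  rw [continuous_iff_continuousAt]
  intro t
  exact (FiniteMeasure.tendsto_iff_forall_integral_tendsto.1 (h.continuous_mass.tendsto t))
    (BoundedContinuousFunction.mkOfCompact ⟨f, hf⟩)

/-- Equicontinuity estimate: along a solution of finite action, the increments of `t ↦ ∫ f dμ_t`
are controlled by the action. Optimising in `c` gives a Hölder estimate of exponent `1/2`. -/
theorem ContinuityEquation.abs_integral_sub_le (h : ContinuityEquation K μ ν ζ) (hK : IsCompact K)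
    {δ : ℝ} (hδ : 0 < δ) {A : ℝ} (hA0 : 0 ≤ A) (hA : totalAction δ μ ν ζ ≤ ENNReal.ofReal A)
    {f : EuclideanSpace ℝ (Fin d) → ℝ} (hf : ContDiff ℝ 1 f) (hfc : HasCompactSupport f) {C : ℝ}
    (hC : ∀ t, (∫ x : K, ‖gradient f x‖ ^ 2 ∂(μ t : Measure K)) / 4 +
      δ * (∫ x : K, ‖f x‖ ^ 2 ∂(lebesgueOn K)) / 4 ≤ C) {c : ℝ} (hc : 0 < c) {s t : I}
    (hst : s ≤ t) :
    |∫ x : K, f x ∂(μ t : Measure K) - ∫ x : K, f x ∂(μ s : Measure K)| ≤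
      A / c + c * C * ((t : ℝ) - s) := by
  have := isFiniteMeasure_lebesgueOn hK
  have hC0 : 0 ≤ C := le_trans (by positivity) (hC 0)
  obtain ⟨L, hL⟩ := exists_gradient_norm_le hf hfc
  obtain ⟨B, hB⟩ := hf.continuous.bounded_above_of_compact_support hfc
  have hgm : StronglyMeasurable fun x : K => gradient f x :=
    ((continuous_gradient_of_contDiff hf).comp continuous_subtype_val).stronglyMeasurable
  have hfm : StronglyMeasurable fun x : K => f x :=
    (hf.continuous.comp continuous_subtype_val).stronglyMeasurable
  obtain ⟨h1, h2⟩ := h.integrable_weakDerivative hf hfc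
  have key : ∀ b : ℝ, b ^ 2 = c ^ 2 → b * (∫ x : K, f x ∂(μ t : Measure K)) -
      b * (∫ x : K, f x ∂(μ s : Measure K)) ≤ A + c ^ 2 * C * ((t : ℝ) - s) := by
    intro b hb
    refine ((h.isWeakDerivative hf hfc).const_mul b).sub_le (continuous_const.mul
      (h.continuous_integral hK (hf.continuous.comp continuous_subtype_val)))
      ((h1.add h2).const_mul b) (by positivity) ((lintegral_mono fun r => ?_).trans hA) hA0 hst
    -- the fields `b ∇f` and `b δ f` make the affine minorant equal to `b` times the weak
    -- derivative, up to quadratic terms bounded by `c² C`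
    have hd := ofReal_pairing_sub_le_action hδ (lebesgueOn K) (μ r : Measure K) (ν r) (ζ r)
      (f := b • fun x : K => gradient f x) (g := (b * δ) • fun x : K => f x)
      (hgm.const_smul b) ⟨|b| * L, fun x => by
        rw [Pi.smul_apply, norm_smul, Real.norm_eq_abs]; gcongr; exact hL x⟩
      (hfm.const_smul (b * δ)) ⟨|b * δ| * B, fun x => by
        rw [Pi.smul_apply, norm_smul, Real.norm_eq_abs]; gcongr; exact hB x⟩
    refine le_trans (ENNReal.ofReal_le_ofReal ?_) hd
    simp only [pairing_smul, Pi.smul_apply, norm_smul, mul_pow, Real.norm_eq_abs, sq_abs,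
      integral_const_mul]
    have h3 := mul_le_mul_of_nonneg_left (hC r) (sq_nonneg c)
    simp only [Real.norm_eq_abs, sq_abs] at h3
    rw [hb]
    refine le_trans (sub_le_sub_left h3 _) (le_of_eq ?_)
    field_simp
    ring
  -- both signs of `b` are needed for the absolute value
  have h3 := key c rfl
  have h4 := key (-c) (neg_sq c)
  have h5 : A / c + c * C * ((t : ℝ) - s) = (A + c ^ 2 * C * ((t : ℝ) - s)) / c := by
    field_simp
  rw [h5, abs_le, ← neg_div, div_le_iff₀ hc, le_div_iff₀ hc]
  constructor <;> linarith

/-- A cutoff equal to `1` in a neighbourhood of `K`, so that its gradient vanishes on `K`. -/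
theorem exists_cutoff (hK : IsCompact K) : ∃ χ : EuclideanSpace ℝ (Fin d) → ℝ, ContDiff ℝ 1 χ ∧
    HasCompactSupport χ ∧ ∀ x ∈ K, χ =ᶠ[𝓝 x] 1 := by
  obtain ⟨R, hR0, hR⟩ := hK.isBounded.subset_ball_lt 0 0
  let φ : ContDiffBump (0 : EuclideanSpace ℝ (Fin d)) := ⟨R, R + 1, hR0, by linarith⟩
  exact ⟨φ, φ.contDiff, φ.hasCompactSupport, fun x hx =>
    φ.eventuallyEq_one_of_mem_ball (hR hx)⟩

/-- The mass at time `t` is controlled by the initial mass and the action: the total mass is the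
integral of a cutoff whose gradient vanishes on `K`, so that only the source term contributes. -/
theorem ContinuityEquation.mass_le (h : ContinuityEquation K μ ν ζ) (hK : IsCompact K)
    {δ : ℝ} (hδ : 0 < δ) {A : ℝ} (hA0 : 0 ≤ A) (hA : totalAction δ μ ν ζ ≤ ENNReal.ofReal A)
    (t : I) : (μ t : Measure K).real univ ≤
      (μ 0 : Measure K).real univ + A + δ * (lebesgueOn K).real univ / 4 := by
  obtain ⟨χ, h1, h2, h3⟩ := exists_cutoff hK
  have e1 : ∀ x : K, χ x = 1 := fun x => (h3 x x.2).eq_of_nhds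
  have e2 : ∀ x : K, gradient χ x = 0 := fun x => by
    rw [(h3 x x.2).gradient.eq_of_nhds]
    exact gradient_const _ _
  have := h.abs_integral_sub_le hK hδ hA0 hA h1 h2 (C := δ * (lebesgueOn K).real univ / 4)
    (fun t => by simp [e1, e2]) one_pos (s := 0) (t := t) t.2.1
  simp only [e1, integral_const, smul_eq_mul, mul_one] at this
  have h4 := (abs_le.1 this).2
  have h5 : 0 ≤ δ * (lebesgueOn K).real univ / 4 := by positivity
  have h6 := t.2.2
  simp only [Icc.coe_zero, div_one, one_mul] at h4
  nlinarith

end Increments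

/-! ### Space-time measures of weakly continuous families; extraction lemmas -/

section SpaceTimeMass

variable {X : Type*} [MeasurableSpace X] [TopologicalSpace X] [BorelSpace X]

theorem measurable_of_continuous_finiteMeasure [HasOuterApproxClosed X] {T : Type*}
    [TopologicalSpace T] [MeasurableSpace T] [OpensMeasurableSpace T] {μ : T → FiniteMeasure X}
    (hμ : Continuous μ) : Measurable fun t => (μ t : Measure X) := by
  have hc : ∀ f : BoundedContinuousFunction X NNReal,
      Measurable fun t => ∫⁻ x, f x ∂(μ t : Measure X) := fun f => by
    refine Continuous.measurable (continuous_iff_continuousAt.2 fun t => ?_)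
    exact FiniteMeasure.tendsto_iff_forall_lintegral_tendsto.1 (hμ.tendsto t) f
  have hF : ∀ F : Set X, IsClosed F → Measurable fun t => (μ t : Measure X) F := fun F hF =>
    measurable_of_tendsto_metrizable (fun n => hc (hF.apprSeq n))
      (tendsto_pi_nhds.2 fun t =>
        HasOuterApproxClosed.tendsto_lintegral_apprSeq hF (μ t : Measure X))
  exact Measurable.measure_of_isPiSystem
    ((BorelSpace.measurable_eq (α := X)).trans borel_eq_generateFrom_isClosed) isPiSystem_isClosed
    hF (hF univ isClosed_univ)

/-- A weakly continuous family of finite measures, viewed as a kernel. -/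
noncomputable def massKernel [HasOuterApproxClosed X] (μ : I → FiniteMeasure X)
    (hμ : Continuous μ) : ProbabilityTheory.Kernel I X :=
  ⟨fun t => (μ t : Measure X), measurable_of_continuous_finiteMeasure hμ⟩

instance [HasOuterApproxClosed X] (μ : I → FiniteMeasure X) (hμ : Continuous μ) :
    ProbabilityTheory.IsFiniteKernel (massKernel μ hμ) := by
  obtain ⟨C, hC⟩ := (isCompact_range (FiniteMeasure.continuous_mass.comp hμ)).bddAbove
  refine ⟨C, ENNReal.coe_lt_top, fun t => ?_⟩
  change (μ t : Measure X) univ ≤ C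
  rw [← FiniteMeasure.ennreal_mass]
  exact_mod_cast hC ⟨t, rfl⟩

/-- The space-time measure `∫₀¹ δ_t ⊗ μ_t dt` of a weakly continuous family of finite measures. -/
noncomputable def spaceTimeMass [HasOuterApproxClosed X] (μ : I → FiniteMeasure X)
    (hμ : Continuous μ) : Measure (I × X) :=
  Measure.compProd volume (massKernel μ hμ)

instance [HasOuterApproxClosed X] (μ : I → FiniteMeasure X) (hμ : Continuous μ) :
    IsFiniteMeasure (spaceTimeMass μ hμ) := by
  unfold spaceTimeMass; infer_instance

variable [HasOuterApproxClosed X] {V : Type*} [NormedAddCommGroup V]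

theorem ae_integrable_spaceTimeMass {μ : I → FiniteMeasure X} (hμ : Continuous μ)
    {f : I × X → V} (hf : Integrable f (spaceTimeMass μ hμ)) :
    ∀ᵐ t : I, Integrable (fun x => f (t, x)) (μ t : Measure X) :=
  ((Measure.integrable_compProd_iff hf.aestronglyMeasurable).1 hf).1

theorem integrable_integral_norm_spaceTimeMass {μ : I → FiniteMeasure X} (hμ : Continuous μ)
    {f : I × X → V} (hf : Integrable f (spaceTimeMass μ hμ)) :
    Integrable fun t : I => ∫ x, ‖f (t, x)‖ ∂(μ t : Measure X) :=
  ((Measure.integrable_compProd_iff hf.aestronglyMeasurable).1 hf).2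

variable [NormedSpace ℝ V]

theorem integral_spaceTimeMass {μ : I → FiniteMeasure X} (hμ : Continuous μ) {f : I × X → V}
    (hf : Integrable f (spaceTimeMass μ hμ)) :
    ∫ p, f p ∂(spaceTimeMass μ hμ) = ∫ t : I, ∫ x, f (t, x) ∂(μ t : Measure X) :=
  Measure.integral_compProd hf

theorem lintegral_spaceTimeMass {μ : I → FiniteMeasure X} (hμ : Continuous μ) {f : I × X → ℝ≥0∞}
    (hf : Measurable f) :
    ∫⁻ p, f p ∂(spaceTimeMass μ hμ) = ∫⁻ t : I, ∫⁻ x, f (t, x) ∂(μ t : Measure X) :=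
  Measure.lintegral_compProd hf

theorem integrable_integral_spaceTimeMass {μ : I → FiniteMeasure X} (hμ : Continuous μ)
    {f : I × X → V} (hf : Integrable f (spaceTimeMass μ hμ)) :
    Integrable fun t : I => ∫ x, f (t, x) ∂(μ t : Measure X) :=
  Integrable.integral_compProd (a := ()) hf

end SpaceTimeMass

section Compactness

/-- Diagonal extraction: a sequence of bounded functions on a countable set has a pointwise
convergent subsequence. -/
theorem exists_subseq_forall_tendsto {ι : Type*} [Countable ι] (u : ℕ → ι → ℝ)
    (hb : ∀ i, ∃ C, ∀ n, |u n i| ≤ C) :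
    ∃ k : ℕ → ℕ, StrictMono k ∧ ∀ i, ∃ l, Tendsto (fun n => u (k n) i) atTop (𝓝 l) := by
  choose C hC using hb
  have hc : IsCompact (univ.pi fun i => Icc (-C i) (C i)) :=
    isCompact_univ_pi fun i => isCompact_Icc
  obtain ⟨l, -, k, hk, hl⟩ := hc.tendsto_subseq (x := u) fun n i _ => abs_le.1 (hC i n)
  exact ⟨k, hk, fun i => ⟨l i, (tendsto_pi_nhds.1 hl) i⟩⟩

/-- A real sequence which is uniformly approximated by convergent sequences converges. -/
theorem exists_tendsto_of_forall_approx {u : ℕ → ℝ}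
    (h : ∀ ε > 0, ∃ v : ℕ → ℝ, (∃ l, Tendsto v atTop (𝓝 l)) ∧ ∀ n, |u n - v n| ≤ ε) :
    ∃ l, Tendsto u atTop (𝓝 l) := by
  refine cauchySeq_tendsto_of_complete (Metric.cauchySeq_iff'.2 fun ε hε => ?_)
  obtain ⟨v, ⟨l, hl⟩, huv⟩ := h (ε / 4) (by linarith)
  obtain ⟨N, hN⟩ := Metric.cauchySeq_iff'.1 hl.cauchySeq (ε / 4) (by linarith)
  refine ⟨N, fun n hn => ?_⟩
  have h1 := abs_le.1 (huv n)
  have h2 := abs_le.1 (huv N)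
  have h3 := hN n hn
  rw [Real.dist_eq, abs_lt] at h3 ⊢
  constructor <;> linarith

/-- On a compact space, a sequence of measures of bounded mass whose integrals of continuous
functions all converge is weakly convergent. The limit is a cluster point, which exists by
compactness. -/
theorem MeasureTheory.FiniteMeasure.exists_tendsto_of_forall_integral {X : Type*}
    [MeasurableSpace X] [TopologicalSpace X] [CompactSpace X] [T2Space X] [BorelSpace X]
    {ρ : ℕ → FiniteMeasure X}
    {M : NNReal} (hM : ∀ n, (ρ n).mass ≤ M)
    (h : ∀ f : C(X, ℝ), ∃ l, Tendsto (fun n => ∫ x, f x ∂(ρ n : Measure X)) atTop (𝓝 l)) :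
    ∃ ρ', Tendsto ρ atTop (𝓝 ρ') := by
  obtain ⟨ρ', -, hρ'⟩ :=
    (isCompact_setOfPred_finiteMeasure_le_of_compactSpace X M).exists_mapClusterPt (f := atTop)
      (u := ρ) (tendsto_principal.2 (Eventually.of_forall hM))
  refine ⟨ρ', FiniteMeasure.tendsto_iff_forall_integral_tendsto.2 fun f => ?_⟩
  obtain ⟨l, hl⟩ := h f.toContinuousMap
  have hc : ContinuousAt (fun ρ : FiniteMeasure X => ∫ x, f x ∂(ρ : Measure X)) ρ' :=
    FiniteMeasure.tendsto_iff_forall_integral_tendsto.1 tendsto_id f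
  have h1 := hρ'.continuousAt_comp hc
  have : ∫ x, f x ∂(ρ' : Measure X) = l := by
    have h2 : ClusterPt (∫ x, f x ∂(ρ' : Measure X)) (𝓝 l) := ClusterPt.mono h1 hl
    exact eq_of_nhds_neBot h2
  rw [this]
  exact hl

/-- Compactly supported `C¹` functions are uniformly dense in the continuous functions on a
compact set. -/
theorem exists_contDiff_approx {d : ℕ} {K : Set (EuclideanSpace ℝ (Fin d))} (hK : IsCompact K)
    (g : C(K, ℝ)) {ε : ℝ} (hε : 0 < ε) : ∃ f : EuclideanSpace ℝ (Fin d) → ℝ, ContDiff ℝ 1 f ∧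
      HasCompactSupport f ∧ ∀ x : K, |f x - g x| < ε := by
  obtain ⟨G, hG⟩ := ContinuousMap.exists_restrict_eq hK.isClosed g
  obtain ⟨χ, h1, h2, h3⟩ := exists_cutoff hK
  have hd := ContinuousMap.dense_setOfPred_contDiff (E := EuclideanSpace ℝ (Fin d)) (F := ℝ) G
  rw [mem_closure_iff_nhds_basis
    (nhds_basis_uniformity Metric.uniformity_basis_dist.compactConvergenceUniformity)] at hd
  obtain ⟨f, hf, hfG⟩ := hd (K, ε) ⟨hK, hε⟩
  rw [mem_ofPred_eq] at hf
  refine ⟨fun x => χ x * f x, h1.mul (hf.of_le (by exact_mod_cast le_top)), h2.mul_right,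
    fun x => ?_⟩
  have h4 := hfG x x.2
  simp only [mem_ofPred_eq, Real.dist_eq] at h4
  have h5 : G x = g x := by rw [← hG]; rfl
  change |χ x * f x - g x| < ε
  rw [(h3 x x.2).eq_of_nhds, Pi.one_apply, one_mul, ← h5]
  exact h4

end Compactness

/-! ### Space-time dual bounds -/

section TotalPairing

variable {X : Type*} [MeasurableSpace X]
variable {V : Type*} [NormedAddCommGroup V] [InnerProductSpace ℝ V]

/-- The time integral `∫₀¹ ∫ ⟨f(t, x), dν_t(x)⟩ dt`. -/
noncomputable def totalPairing (ν : I → VectorMeasure X V) (f : I × X → V) : ℝ :=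
  ∫ t : I, pairing (fun x => f (t, x)) (ν t)

theorem totalPairing_smul (ν : I → VectorMeasure X V) (c : ℝ) (f : I × X → V) :
    totalPairing ν (c • f) = c * totalPairing ν f := by
  unfold totalPairing
  rw [← integral_const_mul]
  congr 1
  ext t
  exact pairing_smul (ν t) c _

theorem totalPairing_zero (ν : I → VectorMeasure X V) : totalPairing ν 0 = 0 := by
  simpa using totalPairing_smul ν 0 0

variable [FiniteDimensional ℝ V] [MeasurableSpace V] [BorelSpace V]

theorem totalPairing_add {ν : I → VectorMeasure X V} (h : IsBorelFamily ν)
    (h' : HasIntegrableMass ν) {f g : I × X → V} (hf : StronglyMeasurable f)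
    (hg : StronglyMeasurable g) (hfb : ∃ C, ∀ p, ‖f p‖ ≤ C) (hgb : ∃ C, ∀ p, ‖g p‖ ≤ C) :
    totalPairing ν (f + g) = totalPairing ν f + totalPairing ν g := by
  unfold totalPairing
  rw [← integral_add (h.integrable_pairing h' hf hfb) (h.integrable_pairing h' hg hgb)]
  congr 1
  ext t
  obtain ⟨C, hC⟩ := hfb
  obtain ⟨C', hC'⟩ := hgb
  exact pairing_add (ν t) (hf.comp_measurable measurable_prodMk_left)
    (hg.comp_measurable measurable_prodMk_left) ⟨C, fun _ => hC _⟩ ⟨C', fun _ => hC' _⟩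

end TotalPairing

theorem ContinuousMap.exists_forall_norm_le {Y V : Type*} [TopologicalSpace Y] [CompactSpace Y]
    [NormedAddCommGroup V] (F : C(Y, V)) : ∃ C, ∀ p, ‖F p‖ ≤ C :=
  ⟨‖F‖, F.norm_coe_le_norm⟩

/-- A homogeneous functional dominated by a constant plus the square of a seminorm is bounded by
a multiple of the seminorm. -/
theorem abs_le_of_forall_sub_sq_le {W : Type*} [AddCommGroup W] [Module ℝ W] {T p : W → ℝ}
    (hT : ∀ (c : ℝ) x, T (c • x) = c * T x) (hp : ∀ (c : ℝ) x, p (c • x) = |c| * p x)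
    (hp0 : ∀ x, 0 ≤ p x) {A q : ℝ} (h : ∀ x, T x - q * p x ^ 2 ≤ A) (x : W) :
    |T x| ≤ (A + q) * p x := by
  rcases (hp0 x).eq_or_lt with hx | hx
  -- where `p` vanishes, `T` is bounded above on a line, hence zero
  · rw [← hx, mul_zero]
    by_contra! h0
    have hTx : T x ≠ 0 := abs_pos.1 h0
    have := h (((A + 1) / T x) • x)
    rw [hT, hp, ← hx, div_mul_cancel₀ _ hTx] at this
    simp at this
    linarith
  have h1 := h ((p x)⁻¹ • x)
  have h2 := h ((-(p x)⁻¹) • x)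
  rw [hT, hp, abs_inv, abs_of_pos hx, inv_mul_cancel₀ hx.ne'] at h1
  rw [hT, hp, abs_neg, abs_inv, abs_of_pos hx, inv_mul_cancel₀ hx.ne'] at h2
  have e : ∀ a : ℝ, a * (p x)⁻¹ * p x = a := fun a => by field_simp
  have h3 := mul_le_mul_of_nonneg_right (show T x * (p x)⁻¹ ≤ A + q by linarith) hx.le
  have h4 := mul_le_mul_of_nonneg_right (show -T x * (p x)⁻¹ ≤ A + q by linarith) hx.le
  rw [e] at h3 h4
  exact abs_le.2 ⟨by linarith, h3⟩

section Bounds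

variable {d : ℕ} {K : Set (EuclideanSpace ℝ (Fin d))}

/-- The constant family equal to Lebesgue measure on a compact set. -/
noncomputable def constLebesgue (hK : IsCompact K) : I → FiniteMeasure K :=
  fun _ => ⟨lebesgueOn K, isFiniteMeasure_lebesgueOn hK⟩

theorem continuous_constLebesgue (hK : IsCompact K) : Continuous (constLebesgue hK) :=
  continuous_const

variable {μ : I → FiniteMeasure K} {ν : I → VectorMeasure K (EuclideanSpace ℝ (Fin d))}
  {ζ : I → SignedMeasure K}

theorem integrable_norm_sq_spaceTimeMass [CompactSpace K] {V : Type*} [NormedAddCommGroup V]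
    [NormedSpace ℝ V] {μ : I → FiniteMeasure K} (hμ : Continuous μ) (F : C(I × K, V)) :
    Integrable (fun p => ‖F p‖ ^ 2) (spaceTimeMass μ hμ) :=
  integrable_norm_sq_of_bounded F.continuous.stronglyMeasurable F.exists_forall_norm_le

/-- Space-time dual lower bound: every pair of continuous fields provides a lower bound for the
total action. -/
theorem ContinuityEquation.ofReal_totalPairing_sub_le (h : ContinuityEquation K μ ν ζ)
    [CompactSpace K] (hK : IsCompact K) {δ : ℝ} (hδ : 0 < δ)
    (F : C(I × K, EuclideanSpace ℝ (Fin d))) (G : C(I × K, ℝ)) :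
    ENNReal.ofReal (totalPairing ν F -
        (∫ p, ‖F p‖ ^ 2 ∂(spaceTimeMass μ h.continuous_mass)) / 4 +
      1 / δ * (totalPairing ζ G -
        (∫ p, ‖G p‖ ^ 2 ∂(spaceTimeMass (constLebesgue hK) (continuous_constLebesgue hK))) / 4)) ≤
      totalAction δ μ ν ζ := by
  have := isFiniteMeasure_lebesgueOn hK
  have hF := F.continuous.stronglyMeasurable
  have hG := G.continuous.stronglyMeasurable
  have i1 := h.borel_flux.integrable_pairing h.integrable_flux hF F.exists_forall_norm_le
  have i2 := h.borel_source.integrable_pairing h.integrable_source hG G.exists_forall_norm_le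
  have j1 := integrable_norm_sq_spaceTimeMass h.continuous_mass F
  have j2 := integrable_norm_sq_spaceTimeMass (continuous_constLebesgue hK) G
  have i3 := integrable_integral_spaceTimeMass _ j1
  have i4 := integrable_integral_spaceTimeMass _ j2
  have i5 : Integrable fun t => pairing (fun x => F (t, x)) (ν t) -
      (∫ x, ‖F (t, x)‖ ^ 2 ∂(μ t : Measure K)) / 4 := i1.sub (i3.div_const 4)
  have i6 : Integrable fun t => 1 / δ * (pairing (fun x => G (t, x)) (ζ t) -
      (∫ x, ‖G (t, x)‖ ^ 2 ∂(constLebesgue hK t : Measure K)) / 4) :=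
    (i2.sub (i4.div_const 4)).const_mul (1 / δ)
  rw [integral_spaceTimeMass _ j1, integral_spaceTimeMass _ j2]
  unfold totalPairing
  rw [← integral_div, ← integral_div, ← integral_sub i1 (i3.div_const 4),
    ← integral_sub i2 (i4.div_const 4), ← integral_const_mul,
    ← integral_add i5 i6]
  refine (ofReal_integral_le_lintegral_ofReal (i5.add i6)).trans (lintegral_mono fun t => ?_)
  exact ofReal_pairing_sub_le_action hδ (lebesgueOn K) (μ t : Measure K) (ν t) (ζ t)
    (hF.comp_measurable measurable_prodMk_left) ⟨‖F‖, fun x => F.norm_coe_le_norm _⟩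
    (hG.comp_measurable measurable_prodMk_left) ⟨‖G‖, fun x => G.norm_coe_le_norm _⟩

theorem integral_norm_sq_spaceTimeMass_le [CompactSpace K] {V : Type*} [NormedAddCommGroup V]
    [NormedSpace ℝ V] {μ : I → FiniteMeasure K} (hμ : Continuous μ) {M : ℝ}
    (hM : ∀ t, (μ t : Measure K).real univ ≤ M) (F : C(I × K, V)) :
    ∫ p, ‖F p‖ ^ 2 ∂(spaceTimeMass μ hμ) ≤ M * ‖F‖ ^ 2 := by
  have j := integrable_norm_sq_spaceTimeMass hμ F
  rw [integral_spaceTimeMass hμ j]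
  have h1 : ∀ t, ∫ x, ‖F (t, x)‖ ^ 2 ∂(μ t : Measure K) ≤ M * ‖F‖ ^ 2 := fun t => by
    calc ∫ x, ‖F (t, x)‖ ^ 2 ∂(μ t : Measure K)
        ≤ ∫ x, ‖F‖ ^ 2 ∂(μ t : Measure K) := by
          refine integral_mono (integrable_norm_sq_of_bounded
            (F.continuous.stronglyMeasurable.comp_measurable measurable_prodMk_left)
            ⟨‖F‖, fun x => F.norm_coe_le_norm _⟩) (integrable_const _) fun x => ?_
          have := F.norm_coe_le_norm (t, x)
          simp only
          gcongr
      _ ≤ M * ‖F‖ ^ 2 := by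
          rw [integral_const, smul_eq_mul]
          gcongr
          exact hM t
  calc _ ≤ ∫ t : I, M * ‖F‖ ^ 2 :=
        integral_mono (integrable_integral_spaceTimeMass hμ j) (integrable_const _) h1
    _ = M * ‖F‖ ^ 2 := by simp

/-- The fluxes of solutions of bounded action and mass are bounded as functionals on continuous
fields. -/
theorem ContinuityEquation.abs_totalPairing_flux_le (h : ContinuityEquation K μ ν ζ)
    [CompactSpace K] (hK : IsCompact K) {δ : ℝ} (hδ : 0 < δ) {A M : ℝ} (hA0 : 0 ≤ A)
    (hA : totalAction δ μ ν ζ ≤ ENNReal.ofReal A) (hM : ∀ t, (μ t : Measure K).real univ ≤ M)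
    (F : C(I × K, EuclideanSpace ℝ (Fin d))) : |totalPairing ν F| ≤ (A + M / 4) * ‖F‖ := by
  refine abs_le_of_forall_sub_sq_le (T := fun F : C(I × K, EuclideanSpace ℝ (Fin d)) =>
    totalPairing ν F) (A := A) (p := norm) (q := M / 4) (fun c x => ?_)
    norm_smul norm_nonneg (fun F => ?_) F
  · rw [ContinuousMap.coe_smul, totalPairing_smul]
  have h1 := (h.ofReal_totalPairing_sub_le hK hδ F 0).trans hA
  rw [ENNReal.ofReal_le_ofReal_iff hA0] at h1
  have h2 := integral_norm_sq_spaceTimeMass_le h.continuous_mass hM F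
  simp only [ContinuousMap.coe_zero, totalPairing_zero, Pi.zero_apply, norm_zero, ne_eq,
    OfNat.ofNat_ne_zero, not_false_eq_true, zero_pow, integral_zero, zero_div, sub_zero, mul_zero,
    add_zero] at h1
  linarith

/-- The sources of solutions of bounded action are bounded as functionals on continuous
functions. -/
theorem ContinuityEquation.abs_totalPairing_source_le (h : ContinuityEquation K μ ν ζ)
    [CompactSpace K] (hK : IsCompact K) {δ : ℝ} (hδ : 0 < δ) {A : ℝ} (hA0 : 0 ≤ A)
    (hA : totalAction δ μ ν ζ ≤ ENNReal.ofReal A) (G : C(I × K, ℝ)) :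
    |totalPairing ζ G| ≤ (δ * A + (lebesgueOn K).real univ / 4) * ‖G‖ := by
  refine abs_le_of_forall_sub_sq_le (T := fun F : C(I × K, ℝ) =>
    totalPairing ζ F) (A := δ * A) (p := norm) (q := (lebesgueOn K).real univ / 4) (fun c x => ?_)
    norm_smul norm_nonneg (fun G => ?_) G
  · rw [ContinuousMap.coe_smul, totalPairing_smul]
  have h1 := (h.ofReal_totalPairing_sub_le hK hδ 0 G).trans hA
  rw [ENNReal.ofReal_le_ofReal_iff hA0] at h1
  have h2 := integral_norm_sq_spaceTimeMass_le (continuous_constLebesgue hK)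
    (M := (lebesgueOn K).real univ) (fun _ => le_rfl) G
  simp only [ContinuousMap.coe_zero, totalPairing_zero, Pi.zero_apply, norm_zero, ne_eq,
    OfNat.ofNat_ne_zero, not_false_eq_true, zero_pow, integral_zero, zero_div, sub_zero,
    zero_add] at h1
  rw [one_div, inv_mul_le_iff₀ hδ] at h1
  change _ ≤ (lebesgueOn K).real univ * ‖G‖ ^ 2 at h2
  linarith

end Bounds

/-! ### Extraction of a convergent subsequence -/

section Extraction

/-- Optimising in `c` the estimate of `ContinuityEquation.abs_integral_sub_le`. -/
theorem abs_sub_le_sqrt_of_forall {h : I → ℝ} {A C : ℝ} (hyp : ∀ c > 0, ∀ s t : I, s ≤ t →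
    |h t - h s| ≤ A / c + c * C * ((t : ℝ) - s)) (s t : I) :
    |h t - h s| ≤ (A + C) * √(dist t s) := by
  wlog hst : s ≤ t generalizing s t
  · rw [abs_sub_comm, dist_comm]
    exact this t s (le_of_not_ge hst)
  rcases hst.eq_or_lt with rfl | hlt
  · simp
  have hd : dist t s = (t : ℝ) - s := by
    rw [Subtype.dist_eq, Real.dist_eq, abs_of_nonneg (sub_nonneg.2 (show (s : ℝ) ≤ t from hst))]
  have hpos : 0 < (t : ℝ) - s := sub_pos.2 (show (s : ℝ) < t from hlt)
  have hsq : 0 < √((t : ℝ) - s) := Real.sqrt_pos.2 hpos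
  -- the choice of `c` that balances the two terms
  refine (hyp (√((t : ℝ) - s))⁻¹ (inv_pos.2 hsq) s t hst).trans (le_of_eq ?_)
  rw [hd, div_inv_eq_mul]
  have : (√((t : ℝ) - s))⁻¹ * ((t : ℝ) - s) = √((t : ℝ) - s) := by
    nth_rewrite 2 [← Real.mul_self_sqrt hpos.le]
    field_simp
  rw [mul_right_comm, this]
  ring

variable {d : ℕ} {K : Set (EuclideanSpace ℝ (Fin d))}

theorem abs_integral_sub_integral_le_of_forall {X : Type*} [MeasurableSpace X] (ρ : Measure X)
    [IsFiniteMeasure ρ] {M : ℝ}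
    (hM : ρ.real univ ≤ M) {f g : X → ℝ} (hf : Integrable f ρ) (hg : Integrable g ρ) {ε : ℝ}
    (hε : 0 ≤ ε) (hfg : ∀ x, |f x - g x| ≤ ε) : |∫ x, f x ∂ρ - ∫ x, g x ∂ρ| ≤ M * ε := by
  rw [← integral_sub hf hg]
  refine (norm_integral_le_of_norm_le_const (f := fun x => f x - g x)
    (Eventually.of_forall hfg)).trans ?_
  rw [mul_comm]
  gcongr

/-- Uniform Hölder estimate for the functions `t ↦ ∫ f dμ_t` along solutions of bounded action. -/
theorem ContinuityEquation.exists_holder_const (hK : IsCompact K) {δ : ℝ} (hδ : 0 < δ)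
    {A M : ℝ} (hA0 : 0 ≤ A) {f : EuclideanSpace ℝ (Fin d) → ℝ} (hf : ContDiff ℝ 1 f)
    (hfc : HasCompactSupport f) : ∃ C, ∀ (μ : I → FiniteMeasure K)
    (ν : I → VectorMeasure K (EuclideanSpace ℝ (Fin d))) (ζ : I → SignedMeasure K),
    ContinuityEquation K μ ν ζ → totalAction δ μ ν ζ ≤ ENNReal.ofReal A →
    (∀ t, (μ t : Measure K).real univ ≤ M) → ∀ s t : I,
    |∫ x : K, f x ∂(μ t : Measure K) - ∫ x : K, f x ∂(μ s : Measure K)| ≤ C * √(dist t s) := by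
  obtain ⟨L, hL⟩ := exists_gradient_norm_le hf hfc
  set R := ∫ x : K, ‖f x‖ ^ 2 ∂(lebesgueOn K)
  refine ⟨A + (M * L ^ 2 / 4 + δ * R / 4), fun μ ν ζ h hA hM => abs_sub_le_sqrt_of_forall
    (h := fun t => ∫ x : K, f x ∂(μ t : Measure K)) fun c hc s t hst => ?_⟩
  refine h.abs_integral_sub_le hK hδ hA0 hA hf hfc (fun r => ?_) hc hst
  have h1 : ∫ x : K, ‖gradient f x‖ ^ 2 ∂(μ r : Measure K) ≤ M * L ^ 2 := by
    calc ∫ x : K, ‖gradient f x‖ ^ 2 ∂(μ r : Measure K)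
        ≤ ∫ x : K, L ^ 2 ∂(μ r : Measure K) := by
          refine integral_mono (integrable_norm_sq_of_bounded
            ((continuous_gradient_of_contDiff hf).comp
              continuous_subtype_val).stronglyMeasurable ⟨L, fun x => hL x⟩)
            (integrable_const _) fun x => ?_
          have := hL x
          simp only
          gcongr
      _ ≤ M * L ^ 2 := by
          rw [integral_const, smul_eq_mul]
          gcongr
          exact hM r
  gcongr

/-- Compactness: along a subsequence, the measures `μ_t` converge for every `t`, to a weakly
continuous family, and all the space-time pairings converge. -/
theorem exists_subseq_tendsto (hK : IsCompact K) [CompactSpace K] {δ : ℝ} (hδ : 0 < δ) {A : ℝ}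
    (hA0 : 0 ≤ A) {M : NNReal} {μ : ℕ → I → FiniteMeasure K}
    {ν : ℕ → I → VectorMeasure K (EuclideanSpace ℝ (Fin d))} {ζ : ℕ → I → SignedMeasure K}
    (hCE : ∀ n, ContinuityEquation K (μ n) (ν n) (ζ n))
    (hA : ∀ n, totalAction δ (μ n) (ν n) (ζ n) ≤ ENNReal.ofReal A)
    (hM : ∀ n t, (μ n t).mass ≤ M) :
    ∃ (k : ℕ → ℕ) (μlim : I → FiniteMeasure K), StrictMono k ∧ Continuous μlim ∧
      (∀ t, Tendsto (fun n => μ (k n) t) atTop (𝓝 (μlim t))) ∧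
      (∀ F : C(I × K, EuclideanSpace ℝ (Fin d)),
        ∃ l, Tendsto (fun n => totalPairing (ν (k n)) F) atTop (𝓝 l)) ∧
      ∀ G : C(I × K, ℝ), ∃ l, Tendsto (fun n => totalPairing (ζ (k n)) G) atTop (𝓝 l) := by
  have hMr : ∀ n t, (μ n t : Measure K).real univ ≤ M := fun n t => hM n t
  have hint : ∀ (g : C(K, ℝ)) (ρ : FiniteMeasure K), Integrable g (ρ : Measure K) := fun g ρ =>
    g.continuous.integrable_of_hasCompactSupport (HasCompactSupport.of_compactSpace _)
  have hcont : ∀ (g : C(K, ℝ)) (ρ : FiniteMeasure K), ContinuousAt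
      (fun ρ : FiniteMeasure K => ∫ x, g x ∂(ρ : Measure K)) ρ := fun g ρ =>
    FiniteMeasure.tendsto_iff_forall_integral_tendsto.1 tendsto_id
      (BoundedContinuousFunction.mkOfCompact g)
  -- a countable dense set of smooth functions
  set S : Set C(K, ℝ) := {g | ∃ f : EuclideanSpace ℝ (Fin d) → ℝ, ContDiff ℝ 1 f ∧
    HasCompactSupport f ∧ ∀ x : K, g x = f x} with hS
  have hSd : Dense S := by
    refine Metric.dense_iff.2 fun g ε hε => ?_
    obtain ⟨f, h1, h2, h3⟩ := exists_contDiff_approx hK g hε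
    refine ⟨⟨fun x => f x, h1.continuous.comp continuous_subtype_val⟩, ?_, f, h1, h2, fun _ => rfl⟩
    rw [Metric.mem_ball, ContinuousMap.dist_lt_iff hε]
    exact h3
  obtain ⟨S', hS'S, hS'c, hS'd⟩ := hSd.exists_countable_dense_subset
  have := hS'c.to_subtype
  set q : ℕ → I := TopologicalSpace.denseSeq I
  set DF : ℕ → C(I × K, EuclideanSpace ℝ (Fin d)) := TopologicalSpace.denseSeq _
  set DG : ℕ → C(I × K, ℝ) := TopologicalSpace.denseSeq _
  have hbF := fun n F => (hCE n).abs_totalPairing_flux_le hK hδ hA0 (hA n) (hMr n) F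
  have hbG := fun n G => (hCE n).abs_totalPairing_source_le hK hδ hA0 (hA n) G
  set CF := A + (M : ℝ) / 4
  set CG := δ * A + (lebesgueOn K).real univ / 4
  have hCF : 0 ≤ CF := by positivity
  have hCG : 0 ≤ CG := by positivity
  set u : ℕ → (S' × ℕ) ⊕ (ℕ ⊕ ℕ) → ℝ := fun n => Sum.elim
    (fun p => ∫ x, p.1.1 x ∂(μ n (q p.2) : Measure K))
    (Sum.elim (fun j => totalPairing (ν n) (DF j)) fun j => totalPairing (ζ n) (DG j)) with hu
  obtain ⟨k, hk, hlim⟩ := exists_subseq_forall_tendsto u (by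
    rintro (⟨g, j⟩ | j | j)
    · refine ⟨‖g.1‖ * M, fun n => ?_⟩
      refine (norm_integral_le_of_norm_le_const
        (Eventually.of_forall g.1.norm_coe_le_norm)).trans ?_
      gcongr
      exact hMr n _
    · exact ⟨_, fun n => hbF n _⟩
    · exact ⟨_, fun n => hbG n _⟩)
  -- convergence against smooth functions at every time, by equicontinuity
  have hsm : ∀ g ∈ S', ∀ t, ∃ l,
      Tendsto (fun n => ∫ x, g x ∂(μ (k n) t : Measure K)) atTop (𝓝 l) := by
    intro g hg t
    obtain ⟨f, h1, h2, h3⟩ := hS'S hg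
    obtain ⟨C, hC⟩ := ContinuityEquation.exists_holder_const (M := M) hK hδ hA0 h1 h2
    refine exists_tendsto_of_forall_approx fun ε hε => ?_
    have hcs : Continuous fun s : I => C * √(dist t s) := by fun_prop
    have hev : ∀ᶠ s in 𝓝 t, C * √(dist t s) < ε := by
      have := hcs.tendsto t
      simp only [dist_self, Real.sqrt_zero, mul_zero] at this
      exact this.eventually (gt_mem_nhds hε)
    obtain ⟨s, hs, j, rfl⟩ := (mem_closure_iff_nhds.1
      ((TopologicalSpace.denseRange_denseSeq I) t)) _ hev
    refine ⟨_, hlim (.inl (⟨g, hg⟩, j)), fun n => ?_⟩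
    have := hC _ _ _ (hCE (k n)) (hA (k n)) (hMr (k n)) (q j) t
    simp only [hu, Sum.elim_inl, h3]
    exact this.trans (le_of_lt hs)
  -- convergence against continuous functions, by density and boundedness of the masses
  have hall : ∀ (g : C(K, ℝ)) t, ∃ l,
      Tendsto (fun n => ∫ x, g x ∂(μ (k n) t : Measure K)) atTop (𝓝 l) := by
    intro g t
    refine exists_tendsto_of_forall_approx fun ε hε => ?_
    have hε' : 0 < ε / (M + 1) := by positivity
    obtain ⟨g', hgg', hg'⟩ := Metric.dense_iff.1 hS'd g _ hε'
    refine ⟨_, hsm g' hg' t, fun n => ?_⟩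
    refine (abs_integral_sub_integral_le_of_forall _ (hMr (k n) t) (hint g _) (hint g' _) hε'.le
      fun x => ?_).trans ?_
    · rw [Metric.mem_ball, dist_comm] at hgg'
      exact (ContinuousMap.dist_apply_le_dist x).trans hgg'.le
    · rw [mul_div_assoc', div_le_iff₀ (by positivity)]
      nlinarith [M.coe_nonneg]
  choose μlim hμlim using fun t =>
    FiniteMeasure.exists_tendsto_of_forall_integral (fun n => hM (k n) t) fun g => hall g t
  have hMlim : ∀ t, (μlim t : Measure K).real univ ≤ M := fun t =>
    NNReal.coe_le_coe.2 (le_of_tendsto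
      (((FiniteMeasure.continuous_mass (Ω := K)).tendsto _).comp (hμlim t))
      (Eventually.of_forall fun n => hM (k n) t))
  have hconv : ∀ (g : C(K, ℝ)) t, Tendsto (fun n => ∫ x, g x ∂(μ (k n) t : Measure K)) atTop
      (𝓝 (∫ x, g x ∂(μlim t : Measure K))) := fun g t => (hcont g _).tendsto.comp (hμlim t)
  -- the Hölder estimate is inherited by the limit
  have hclim : ∀ g ∈ S, Continuous fun t => ∫ x, g x ∂(μlim t : Measure K) := by
    rintro g ⟨f, h1, h2, h3⟩
    obtain ⟨C, hC⟩ := ContinuityEquation.exists_holder_const (M := M) hK hδ hA0 h1 h2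
    have hH : ∀ s t, |∫ x, g x ∂(μlim t : Measure K) - ∫ x, g x ∂(μlim s : Measure K)| ≤
        C * √(dist t s) := fun s t => by
      refine le_of_tendsto ((hconv g t).sub (hconv g s)).abs (Eventually.of_forall fun n => ?_)
      simp only [h3]
      exact hC _ _ _ (hCE (k n)) (hA (k n)) (hMr (k n)) s t
    refine continuous_iff_continuousAt.2 fun s => ?_
    rw [ContinuousAt, tendsto_iff_dist_tendsto_zero]
    have hcs : Continuous fun t : I => C * √(dist t s) := by fun_prop
    have := hcs.tendsto s
    simp only [dist_self, Real.sqrt_zero, mul_zero] at this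
    exact squeeze_zero (fun _ => dist_nonneg) (fun t => hH s t) this
  -- continuity of the limit, from smooth to continuous functions by uniform approximation
  have hμc : Continuous μlim := by
    refine continuous_iff_continuousAt.2 fun t => ?_
    refine FiniteMeasure.tendsto_iff_forall_integral_tendsto.2 fun g => ?_
    have : Continuous fun t => ∫ x, g x ∂(μlim t : Measure K) := by
      refine continuous_of_uniform_approx_of_continuous fun U hU => ?_
      obtain ⟨ε, hε, hεU⟩ := Metric.mem_uniformity_dist.1 hU
      have hε' : 0 < ε / (M + 1) := by positivity
      obtain ⟨g', hgg', hg'⟩ := Metric.dense_iff.1 hS'd g.toContinuousMap _ hε'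
      refine ⟨_, hclim g' (hS'S hg'), fun t => hεU ?_⟩
      have hb := abs_integral_sub_integral_le_of_forall _ (hMlim t) (hint g.toContinuousMap _)
        (hint g' _) hε'.le fun x => by
          rw [Metric.mem_ball, dist_comm] at hgg'
          exact (ContinuousMap.dist_apply_le_dist x).trans hgg'.le
      refine lt_of_le_of_lt hb ?_
      rw [mul_div_assoc', div_lt_iff₀ (by positivity)]
      nlinarith [M.coe_nonneg]
    exact this.tendsto t
  refine ⟨k, μlim, hk, hμc, hμlim, fun F => ?_, fun G => ?_⟩
  · refine exists_tendsto_of_forall_approx fun ε hε => ?_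
    have hε' : 0 < ε / (CF + 1) := by positivity
    obtain ⟨_, hF', j, rfl⟩ := Metric.dense_iff.1 (TopologicalSpace.denseRange_denseSeq
      C(I × K, EuclideanSpace ℝ (Fin d))) F _ hε'
    refine ⟨_, hlim (.inr (.inl j)), fun n => ?_⟩
    have h1 : totalPairing (ν (k n)) F - totalPairing (ν (k n)) (DF j) =
        totalPairing (ν (k n)) (F - DF j : C(I × K, EuclideanSpace ℝ (Fin d))) := by
      have := totalPairing_add (hCE (k n)).borel_flux (hCE (k n)).integrable_flux
        (F - DF j).continuous.stronglyMeasurable (DF j).continuous.stronglyMeasurable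
        (F - DF j).exists_forall_norm_le (DF j).exists_forall_norm_le
      rw [← ContinuousMap.coe_add, sub_add_cancel] at this
      linarith
    simp only [hu, Sum.elim_inr, Sum.elim_inl]
    rw [h1]
    refine (hbF (k n) _).trans ?_
    rw [Metric.mem_ball, dist_comm, dist_eq_norm, lt_div_iff₀ (by positivity)] at hF'
    nlinarith [norm_nonneg (F - DF j)]
  · refine exists_tendsto_of_forall_approx fun ε hε => ?_
    have hε' : 0 < ε / (CG + 1) := by positivity
    obtain ⟨_, hF', j, rfl⟩ := Metric.dense_iff.1 (TopologicalSpace.denseRange_denseSeq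
      C(I × K, ℝ)) G _ hε'
    refine ⟨_, hlim (.inr (.inr j)), fun n => ?_⟩
    have h1 : totalPairing (ζ (k n)) G - totalPairing (ζ (k n)) (DG j) =
        totalPairing (ζ (k n)) (G - DG j : C(I × K, ℝ)) := by
      have := totalPairing_add (hCE (k n)).borel_source (hCE (k n)).integrable_source
        (G - DG j).continuous.stronglyMeasurable (DG j).continuous.stronglyMeasurable
        (G - DG j).exists_forall_norm_le (DG j).exists_forall_norm_le
      rw [← ContinuousMap.coe_add, sub_add_cancel] at this
      linarith
    simp only [hu, Sum.elim_inr]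
    rw [h1]
    refine (hbG (k n) _).trans ?_
    rw [Metric.mem_ball, dist_comm, dist_eq_norm, lt_div_iff₀ (by positivity)] at hF'
    nlinarith [norm_nonneg (G - DG j)]

end Extraction

/-! ### Representation of the limits by densities -/

section Representation

theorem lintegral_norm_sq_eq {Y V : Type*} [MeasurableSpace Y] [NormedAddCommGroup V]
    [InnerProductSpace ℝ V] (ρ : Measure Y) (w : Lp V 2 ρ) :
    ∫⁻ y, ENNReal.ofReal (‖w y‖ ^ 2) ∂ρ = ENNReal.ofReal (‖w‖ ^ 2) := by
  rw [← real_inner_self_eq_norm_sq w, L2.inner_def,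
    ofReal_integral_eq_lintegral_ofReal (L2.integrable_inner w w)
      (Eventually.of_forall fun y => real_inner_self_nonneg)]
  simp only [real_inner_self_eq_norm_sq]

variable {Y : Type*} [TopologicalSpace Y] [CompactSpace Y] [MeasurableSpace Y] [BorelSpace Y]
  {V : Type*} [NormedAddCommGroup V] [InnerProductSpace ℝ V]

theorem inner_toLp_continuousMap [SecondCountableTopologyEither Y V] (ρ : Measure Y)
    [IsFiniteMeasure ρ] (F : C(Y, V)) (w : Lp V 2 ρ) :
    inner ℝ (ContinuousMap.toLp 2 ρ ℝ F) w = ∫ y, inner ℝ (F y) (w y) ∂ρ := by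
  rw [L2.inner_def]
  refine integral_congr_ae ?_
  filter_upwards [ContinuousMap.coeFn_toLp (p := 2) (𝕜 := ℝ) ρ F] with y hy
  rw [hy]

theorem norm_sq_toLp_continuousMap [SecondCountableTopologyEither Y V] (ρ : Measure Y)
    [IsFiniteMeasure ρ] (F : C(Y, V)) :
    ‖(ContinuousMap.toLp 2 ρ ℝ F : Lp V 2 ρ)‖ ^ 2 = ∫ y, ‖F y‖ ^ 2 ∂ρ := by
  rw [← real_inner_self_eq_norm_sq, inner_toLp_continuousMap]
  refine integral_congr_ae ?_
  filter_upwards [ContinuousMap.coeFn_toLp (p := 2) (𝕜 := ℝ) ρ F] with y hy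
  rw [hy, real_inner_self_eq_norm_sq]

variable [TopologicalSpace.MetrizableSpace Y]

/-- Riesz representation in `L²`: a linear functional on continuous fields which is bounded above
by a constant plus `∫ |F|² dρ / 4` is the pairing with an `L²(ρ)` field. -/
theorem exists_L2_representation [CompleteSpace V] [SecondCountableTopologyEither Y V]
    (ρ : Measure Y) [IsFiniteMeasure ρ] (N : C(Y, V) →ₗ[ℝ] ℝ) {A : ℝ}
    (h : ∀ F, N F - (∫ y, ‖F y‖ ^ 2 ∂ρ) / 4 ≤ A) :
    ∃ w : Lp V 2 ρ, ∀ F, N F = inner ℝ (ContinuousMap.toLp 2 ρ ℝ F) w := by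
  have hd : DenseRange (ContinuousMap.toLp 2 ρ ℝ : C(Y, V) →L[ℝ] Lp V 2 ρ) :=
    ContinuousMap.toLp_denseRange V ρ ℝ (by norm_num)
  have hb : ∀ F, ‖N F‖ ≤ (A + 1 / 4) * ‖(ContinuousMap.toLp 2 ρ ℝ F : Lp V 2 ρ)‖ := by
    refine abs_le_of_forall_sub_sq_le (T := N)
      (p := fun F => ‖(ContinuousMap.toLp 2 ρ ℝ F : Lp V 2 ρ)‖) (fun c x => ?_) (fun c x => ?_)
      (fun x => norm_nonneg _) fun F => ?_
    · rw [map_smul, smul_eq_mul]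
    · rw [map_smul, norm_smul, Real.norm_eq_abs]
    · rw [norm_sq_toLp_continuousMap]
      linarith [h F]
  set L := N.extendOfNorm (ContinuousMap.toLp 2 ρ ℝ : C(Y, V) →L[ℝ] Lp V 2 ρ).toLinearMap
  refine ⟨(InnerProductSpace.toDual ℝ _).symm L, fun F => ?_⟩
  rw [real_inner_comm, InnerProductSpace.toDual_symm_apply]
  exact (LinearMap.extendOfNorm_eq hd ⟨_, hb⟩ F).symm

/-- Optimisation over continuous fields of the quadratic expressions of the dual formulation. -/
theorem norm_sq_add_norm_sq_le_of_forall {V' : Type*} [NormedAddCommGroup V']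
    [InnerProductSpace ℝ V'] [SecondCountableTopologyEither Y V]
    [SecondCountableTopologyEither Y V'] (ρ ρ' : Measure Y) [IsFiniteMeasure ρ]
    [IsFiniteMeasure ρ'] (w : Lp V 2 ρ) (z : Lp V' 2 ρ') {A β : ℝ}
    (h : ∀ (F : C(Y, V)) (G : C(Y, V')),
      inner ℝ (ContinuousMap.toLp 2 ρ ℝ F) w - (∫ y, ‖F y‖ ^ 2 ∂ρ) / 4 +
        β * (inner ℝ (ContinuousMap.toLp 2 ρ' ℝ G) z - (∫ y, ‖G y‖ ^ 2 ∂ρ') / 4) ≤ A) :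
    ‖w‖ ^ 2 + β * ‖z‖ ^ 2 ≤ A := by
  have hd := (ContinuousMap.toLp_denseRange V ρ ℝ (p := 2) (by norm_num)).prodMap
    (ContinuousMap.toLp_denseRange V' ρ' ℝ (p := 2) (by norm_num))
  have key : ∀ p : Lp V 2 ρ × Lp V' 2 ρ', inner ℝ p.1 w - ‖p.1‖ ^ 2 / 4 +
      β * (inner ℝ p.2 z - ‖p.2‖ ^ 2 / 4) ≤ A := by
    intro p
    refine hd.induction_on p (isClosed_le (by fun_prop) continuous_const) fun FG => ?_
    have := h FG.1 FG.2
    rw [← norm_sq_toLp_continuousMap, ← norm_sq_toLp_continuousMap] at this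
    exact this
  -- the supremum is attained at twice the representing fields
  have := key ((2 : ℝ) • w, (2 : ℝ) • z)
  simp only [real_inner_smul_left, real_inner_self_eq_norm_sq, norm_smul, mul_pow,
    Real.norm_ofNat] at this
  linarith

end Representation

section DensityFamily

variable {X : Type*} [MeasurableSpace X] {V : Type*} [NormedAddCommGroup V] [InnerProductSpace ℝ V]

/-- The family of vector measures `w(t, ·) μ_t`. -/
noncomputable def densityFamily (μ : I → FiniteMeasure X) (w : I × X → V) :
    I → VectorMeasure X V :=
  fun t => (μ t : Measure X).withDensityᵥ fun x => w (t, x)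

variable [TopologicalSpace X] [BorelSpace X] [HasOuterApproxClosed X]
  {μ : I → FiniteMeasure X} {w : I × X → V}

theorem isBorelFamily_densityFamily [MeasurableSpace V] [BorelSpace V]
    (hμ : Continuous μ) (hw : StronglyMeasurable w) :
    IsBorelFamily (densityFamily μ w) := by
  intro B hB
  have hT : MeasurableSet {t | Integrable (fun x => w (t, x)) (μ t : Measure X)} :=
    ProbabilityTheory.measurableSet_kernel_integrable (κ := massKernel μ hμ) hw
  have hm : Measurable fun t => ∫ x in B, w (t, x) ∂(μ t : Measure X) := by
    have := (hw.indicator (measurable_snd hB)).integral_kernel_prod_right' (κ := massKernel μ hμ)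
    refine Eq.mp (congrArg Measurable (funext fun t => ?_)) this.measurable
    exact integral_indicator (f := fun x => w (t, x)) hB
  classical
  -- `withDensityᵥ` is `0` at the times where the density is not integrable
  have e : (fun t => densityFamily μ w t B) = fun t =>
      if Integrable (fun x => w (t, x)) (μ t : Measure X) then
        ∫ x in B, w (t, x) ∂(μ t : Measure X) else 0 := by
    ext1 t
    split_ifs with h
    · exact withDensityᵥ_apply h hB
    · simp [densityFamily, Measure.withDensityᵥ, h]
  rw [e]
  exact Measurable.ite hT hm measurable_const

variable [FiniteDimensional ℝ V]

theorem hasIntegrableMass_densityFamily (hμ : Continuous μ)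
    (hw : Integrable w (spaceTimeMass μ hμ)) : HasIntegrableMass (densityFamily μ w) := by
  have := FiniteDimensional.complete ℝ V
  refine (integrable_integral_norm_spaceTimeMass hμ hw).congr ?_
  filter_upwards [ae_integrable_spaceTimeMass hμ hw] with t ht
  rw [densityFamily, Measure.variation_withDensityᵥ ht, measureReal_def,
    withDensity_apply _ MeasurableSet.univ, Measure.restrict_univ,
    integral_norm_eq_lintegral_enorm ht.1]

theorem totalPairing_densityFamily (hμ : Continuous μ)
    (hw : Integrable w (spaceTimeMass μ hμ)) {f : I × X → V} (hf : StronglyMeasurable f)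
    (hb : ∃ C, ∀ p, ‖f p‖ ≤ C) :
    totalPairing (densityFamily μ w) f = ∫ p, inner ℝ (f p) (w p) ∂(spaceTimeMass μ hμ) := by
  obtain ⟨C, hC⟩ := hb
  rw [integral_spaceTimeMass hμ (integrable_inner_of_bounded hf ⟨C, hC⟩ hw)]
  refine integral_congr_ae ?_
  filter_upwards [ae_integrable_spaceTimeMass hμ hw] with t ht
  exact pairing_withDensity ht (hf.comp_measurable measurable_prodMk_left) ⟨C, fun x => hC _⟩

end DensityFamily

/-! ### Passage to the limit -/

section Limits

theorem tendsto_integral_spaceTimeMass {X : Type*} [MeasurableSpace X] [TopologicalSpace X]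
    [BorelSpace X] [HasOuterApproxClosed X] [CompactSpace X] [OpensMeasurableSpace (I × X)]
    {μ : ℕ → I → FiniteMeasure X} (hμ : ∀ n, Continuous (μ n)) {μlim : I → FiniteMeasure X}
    (hμlim : Continuous μlim) {M : ℝ} (hM : ∀ n t, (μ n t : Measure X).real univ ≤ M)
    (hlim : ∀ t, Tendsto (fun n => μ n t) atTop (𝓝 (μlim t))) (f : C(I × X, ℝ)) :
    Tendsto (fun n => ∫ p, f p ∂(spaceTimeMass (μ n) (hμ n))) atTop
      (𝓝 (∫ p, f p ∂(spaceTimeMass μlim hμlim))) := by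
  have hint : ∀ (ρ : Measure (I × X)) [IsFiniteMeasure ρ], Integrable f ρ := fun ρ _ =>
    f.continuous.integrable_of_hasCompactSupport (HasCompactSupport.of_compactSpace _)
  rw [integral_spaceTimeMass hμlim (hint _)]
  simp_rw [fun n => integral_spaceTimeMass (hμ n) (hint (spaceTimeMass (μ n) (hμ n)))]
  refine tendsto_integral_of_dominated_convergence (fun _ => ‖f‖ * M)
    (fun n => (integrable_integral_spaceTimeMass (hμ n) (hint _)).1) (integrable_const _)
    (fun n => Eventually.of_forall fun t => ?_) (Eventually.of_forall fun t => ?_)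
  · refine (norm_integral_le_of_norm_le_const
      (Eventually.of_forall fun x => f.norm_coe_le_norm (t, x))).trans ?_
    gcongr
    exact hM n t
  · exact FiniteMeasure.tendsto_iff_forall_integral_tendsto.1 (hlim t)
      (BoundedContinuousFunction.mkOfCompact ⟨fun x => f (t, x), by fun_prop⟩)

/-- The pointwise limit of the functionals `totalPairing (ν n)` on continuous fields is linear. -/
theorem exists_linearMap_tendsto {X : Type*} [MeasurableSpace X] [TopologicalSpace X]
    [CompactSpace X] [OpensMeasurableSpace (I × X)] {V : Type*} [NormedAddCommGroup V]
    [InnerProductSpace ℝ V] [FiniteDimensional ℝ V] [MeasurableSpace V] [BorelSpace V]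
    {ν : ℕ → I → VectorMeasure X V} (hν : ∀ n, IsBorelFamily (ν n))
    (hν' : ∀ n, HasIntegrableMass (ν n))
    (h : ∀ F : C(I × X, V), ∃ l, Tendsto (fun n => totalPairing (ν n) F) atTop (𝓝 l)) :
    ∃ N : C(I × X, V) →ₗ[ℝ] ℝ, ∀ F : C(I × X, V),
      Tendsto (fun n => totalPairing (ν n) F) atTop (𝓝 (N F)) := by
  choose L hL using h
  have hsm : ∀ F : C(I × X, V), StronglyMeasurable F := fun F =>
    F.continuous.stronglyMeasurable_of_hasCompactSupport (HasCompactSupport.of_compactSpace _)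
  refine ⟨⟨⟨L, fun F G => ?_⟩, fun c F => ?_⟩, hL⟩
  · refine tendsto_nhds_unique (hL (F + G)) (((hL F).add (hL G)).congr fun n => ?_)
    rw [ContinuousMap.coe_add, totalPairing_add (hν n) (hν' n) (hsm F) (hsm G)
      F.exists_forall_norm_le G.exists_forall_norm_le]
  · refine tendsto_nhds_unique (hL (c • F)) (((hL F).const_mul c).congr fun n => ?_)
    rw [ContinuousMap.coe_smul, totalPairing_smul]

theorem IsTestFunction.continuous_deriv {d : ℕ} {η : ℝ × EuclideanSpace ℝ (Fin d) → ℝ}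
    (h : IsTestFunction η) :
    Continuous fun p : ℝ × EuclideanSpace ℝ (Fin d) => deriv (fun s : ℝ => η (s, p.2)) p.1 := by
  have hd := h.contDiff.differentiable one_ne_zero
  have e : ∀ p : ℝ × EuclideanSpace ℝ (Fin d),
      deriv (fun s : ℝ => η (s, p.2)) p.1 = fderiv ℝ η p (1, 0) := fun p => by
    have h1 : HasDerivAt (fun s : ℝ => (s, p.2)) ((1 : ℝ), (0 : EuclideanSpace ℝ (Fin d))) p.1 :=
      (hasDerivAt_id _).prodMk (hasDerivAt_const _ _)
    exact ((hd (p.1, p.2)).hasFDerivAt.comp_hasDerivAt p.1 h1).deriv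
  simp_rw [e]
  exact (h.contDiff.continuous_fderiv one_ne_zero).clm_apply continuous_const

theorem IsTestFunction.continuous_gradient {d : ℕ} {η : ℝ × EuclideanSpace ℝ (Fin d) → ℝ}
    (h : IsTestFunction η) :
    Continuous fun p : ℝ × EuclideanSpace ℝ (Fin d) => gradient (fun y => η (p.1, y)) p.2 := by
  have hd := h.contDiff.differentiable one_ne_zero
  have e : ∀ p : ℝ × EuclideanSpace ℝ (Fin d), fderiv ℝ (fun y => η (p.1, y)) p.2 =
      (fderiv ℝ η p).comp (ContinuousLinearMap.inr ℝ ℝ (EuclideanSpace ℝ (Fin d))) := fun p =>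
    ((hd (p.1, p.2)).hasFDerivAt.comp p.2 (hasFDerivAt_prodMk_right p.1 p.2)).fderiv
  unfold gradient
  simp_rw [e]
  exact (InnerProductSpace.toDual ℝ _).symm.continuous.comp
    ((h.contDiff.continuous_fderiv one_ne_zero).clm_comp continuous_const)

variable {d : ℕ} {K : Set (EuclideanSpace ℝ (Fin d))}

/-- Upper bound for the total action of a family given by space-time densities. -/
theorem totalAction_densityFamily_le (hK : IsCompact K) {δ : ℝ}
    {μ : I → FiniteMeasure K} (hμ : Continuous μ) {w : I × K → EuclideanSpace ℝ (Fin d)}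
    (hwm : StronglyMeasurable w) (hw : Integrable w (spaceTimeMass μ hμ)) {z : I × K → ℝ}
    (hzm : StronglyMeasurable z)
    (hz : Integrable z (spaceTimeMass (constLebesgue hK) (continuous_constLebesgue hK))) :
    totalAction δ μ (densityFamily μ w) (densityFamily (constLebesgue hK) z) ≤
      ∫⁻ p, ENNReal.ofReal (‖w p‖ ^ 2) ∂(spaceTimeMass μ hμ) + ENNReal.ofReal (1 / δ) *
        ∫⁻ p, ENNReal.ofReal (‖z p‖ ^ 2)
          ∂(spaceTimeMass (constLebesgue hK) (continuous_constLebesgue hK)) := by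
  have := isFiniteMeasure_lebesgueOn hK
  have m1 : Measurable fun p => ENNReal.ofReal (‖w p‖ ^ 2) :=
    (hwm.norm.pow 2).measurable.ennreal_ofReal
  have m2 : Measurable fun p => ENNReal.ofReal (‖z p‖ ^ 2) :=
    (hzm.norm.pow 2).measurable.ennreal_ofReal
  have m3 : Measurable fun t : I => ∫⁻ x, ENNReal.ofReal (‖w (t, x)‖ ^ 2) ∂(μ t : Measure K) :=
    m1.lintegral_kernel_prod_right' (κ := massKernel μ hμ)
  rw [lintegral_spaceTimeMass hμ m1, lintegral_spaceTimeMass _ m2,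
    ← lintegral_const_mul' _ _ ENNReal.ofReal_ne_top, ← lintegral_add_left m3]
  refine lintegral_mono_ae ?_
  filter_upwards [ae_integrable_spaceTimeMass hμ hw, ae_integrable_spaceTimeMass _ hz]
    with t h1 h2
  refine add_le_add (actionBB_withDensity_le _ _ h1
    (hwm.measurable.comp measurable_prodMk_left)) ?_
  gcongr
  exact actionZ_withDensity_le _ h2

end Limits

section Main

variable {d : ℕ} {K : Set (EuclideanSpace ℝ (Fin d))}

/-- The compactness theorem over an arbitrary compact set, under explicit bounds. -/
theorem exists_subseq_continuityEquation (hK : IsCompact K) {δ : ℝ} (hδ : 0 < δ) {A : ℝ}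
    (hA0 : 0 ≤ A) {M : NNReal} {μ : ℕ → I → FiniteMeasure K}
    {ν : ℕ → I → VectorMeasure K (EuclideanSpace ℝ (Fin d))} {ζ : ℕ → I → SignedMeasure K}
    (hCE : ∀ n, ContinuityEquation K (μ n) (ν n) (ζ n))
    (hA : ∀ n, totalAction δ (μ n) (ν n) (ζ n) ≤ ENNReal.ofReal A)
    (hM : ∀ n t, (μ n t).mass ≤ M) :
    ∃ (k : ℕ → ℕ) (μlim : I → FiniteMeasure K)
      (νlim : I → VectorMeasure K (EuclideanSpace ℝ (Fin d))) (ζlim : I → SignedMeasure K),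
      StrictMono k ∧ ContinuityEquation K μlim νlim ζlim ∧
      (∀ t : I, Tendsto (fun n => μ (k n) t) atTop (𝓝 (μlim t))) ∧
      WeakStarTendsto (fun n => spaceTimeMeasure (ν (k n))) (spaceTimeMeasure νlim) ∧
      WeakStarTendsto (fun n => spaceTimeMeasure (ζ (k n))) (spaceTimeMeasure ζlim) ∧
      totalAction δ μlim νlim ζlim ≤
        liminf (fun n => totalAction δ (μ (k n)) (ν (k n)) (ζ (k n))) atTop := by
  have := isCompact_iff_compactSpace.1 hK
  obtain ⟨k, μlim, hk, hμc, hμlim, hN, hZ⟩ := exists_subseq_tendsto hK hδ hA0 hCE hA hM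
  obtain ⟨N, hN⟩ := exists_linearMap_tendsto (fun n => (hCE (k n)).borel_flux)
    (fun n => (hCE (k n)).integrable_flux) hN
  obtain ⟨Z, hZ⟩ := exists_linearMap_tendsto (fun n => (hCE (k n)).borel_source)
    (fun n => (hCE (k n)).integrable_source) hZ
  have hMr : ∀ n t, (μ (k n) t : Measure K).real univ ≤ M := fun n t => hM (k n) t
  set ρ := spaceTimeMass μlim hμc
  set lc := continuous_constLebesgue hK
  set ρ' := spaceTimeMass (constLebesgue hK) lc
  set L := liminf (fun n => totalAction δ (μ (k n)) (ν (k n)) (ζ (k n))) atTop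
  have hL : L ≠ ∞ := by
    refine ne_top_of_le_ne_top (ENNReal.ofReal_ne_top (r := A)) ?_
    refine (liminf_le_liminf (Eventually.of_forall fun n => hA (k n))).trans (le_of_eq ?_)
    exact liminf_const _
  -- the dual lower bounds pass to the limit
  have hquad : ∀ (F : C(I × K, EuclideanSpace ℝ (Fin d))) (G : C(I × K, ℝ)),
      N F - (∫ p, ‖F p‖ ^ 2 ∂ρ) / 4 + 1 / δ * (Z G - (∫ p, ‖G p‖ ^ 2 ∂ρ') / 4) ≤ L.toReal := by
    intro F G
    have h1 := tendsto_integral_spaceTimeMass (fun n => (hCE (k n)).continuous_mass) hμc hMr hμlim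
      ⟨fun p => ‖F p‖ ^ 2, by fun_prop⟩
    have h2 := ((hN F).sub (h1.div_const 4)).add
      (((hZ G).sub_const ((∫ p, ‖G p‖ ^ 2 ∂ρ') / 4)).const_mul (1 / δ))
    rw [← ENNReal.ofReal_le_iff_le_toReal hL]
    refine (ENNReal.tendsto_ofReal h2).liminf_eq.symm.trans_le ?_
    exact liminf_le_liminf (Eventually.of_forall fun n =>
      (hCE (k n)).ofReal_totalPairing_sub_le hK hδ F G)
  -- hence the limit functionals are given by square integrable densities
  obtain ⟨w, hw⟩ := exists_L2_representation ρ N (A := L.toReal) fun F => by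
    simpa using hquad F 0
  obtain ⟨z, hz⟩ := exists_L2_representation ρ' Z (A := δ * L.toReal) fun G => by
    have := hquad 0 G
    simp only [map_zero, ContinuousMap.coe_zero, Pi.zero_apply, norm_zero, ne_eq,
      OfNat.ofNat_ne_zero, not_false_eq_true, zero_pow, integral_zero, zero_div, sub_zero,
      zero_add] at this
    rwa [one_div, inv_mul_le_iff₀ hδ] at this
  have hwm := Lp.stronglyMeasurable w
  have hzm := Lp.stronglyMeasurable z
  have hwi : Integrable w ρ := (Lp.memLp w).integrable one_le_two
  have hzi : Integrable z ρ' := (Lp.memLp z).integrable one_le_two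
  have hνb : IsBorelFamily (densityFamily μlim w) := isBorelFamily_densityFamily hμc hwm
  have hζb : IsBorelFamily (densityFamily (constLebesgue hK) z) :=
    isBorelFamily_densityFamily lc hzm
  have hνm : HasIntegrableMass (densityFamily μlim w) := hasIntegrableMass_densityFamily hμc hwi
  have hζm : HasIntegrableMass (densityFamily (constLebesgue hK) z) :=
    hasIntegrableMass_densityFamily lc hzi
  have hν : ∀ F : C(I × K, EuclideanSpace ℝ (Fin d)),
      Tendsto (fun n => totalPairing (ν (k n)) F) atTop
        (𝓝 (totalPairing (densityFamily μlim w) F)) := fun F => by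
    rw [totalPairing_densityFamily hμc hwi F.continuous.stronglyMeasurable
      F.exists_forall_norm_le, ← inner_toLp_continuousMap, ← hw]
    exact hN F
  have hζ : ∀ G : C(I × K, ℝ), Tendsto (fun n => totalPairing (ζ (k n)) G) atTop
      (𝓝 (totalPairing (densityFamily (constLebesgue hK) z) G)) := fun G => by
    rw [totalPairing_densityFamily lc hzi G.continuous.stronglyMeasurable
      G.exists_forall_norm_le, ← inner_toLp_continuousMap, ← hz]
    exact hZ G
  refine ⟨k, μlim, densityFamily μlim w, densityFamily (constLebesgue hK) z, hk,
    ⟨hμc, hνb, hζb, hνm, hζm, fun η hη => ?_⟩, hμlim, fun F => ?_, fun G => ?_, ?_⟩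
  · set c : I × K → ℝ × EuclideanSpace ℝ (Fin d) := fun p => ((p.1 : ℝ), (p.2 : _))
    have hc : Continuous c := by fun_prop
    have t1 := tendsto_integral_spaceTimeMass (fun n => (hCE (k n)).continuous_mass) hμc hMr hμlim
      ⟨_, hη.continuous_deriv.comp hc⟩
    have t2 := hν ⟨_, hη.continuous_gradient.comp hc⟩
    have t3 := hζ ⟨_, hη.contDiff.continuous.comp hc⟩
    have hint : ∀ (ρ : Measure (I × K)) [IsFiniteMeasure ρ], Integrable ((fun p : ℝ ×
        EuclideanSpace ℝ (Fin d) => deriv (fun s : ℝ => η (s, p.2)) p.1) ∘ c) ρ := fun ρ _ =>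
      (hη.continuous_deriv.comp hc).integrable_of_hasCompactSupport
        (HasCompactSupport.of_compactSpace _)
    have h1 := tendsto_nhds_unique (((t1.add t2).add t3).congr fun n => ?_)
      (tendsto_const_nhds (x := (0 : ℝ)))
    · rw [ContinuousMap.coe_mk, integral_spaceTimeMass hμc (hint ρ)] at h1
      exact h1
    · rw [ContinuousMap.coe_mk, integral_spaceTimeMass (hCE (k n)).continuous_mass (hint _)]
      exact (hCE (k n)).equation η hη
  · have e : ∀ n, pairing F (spaceTimeMeasure (ν (k n))) = totalPairing (ν (k n)) F := fun n =>
      (hCE (k n)).borel_flux.pairing_spaceTimeMeasure (hCE (k n)).integrable_flux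
        F.continuous.stronglyMeasurable F.exists_forall_norm_le
    rw [hνb.pairing_spaceTimeMeasure hνm F.continuous.stronglyMeasurable F.exists_forall_norm_le]
    simp_rw [e]
    exact hν F
  · have e : ∀ n, pairing G (spaceTimeMeasure (ζ (k n))) = totalPairing (ζ (k n)) G := fun n =>
      (hCE (k n)).borel_source.pairing_spaceTimeMeasure (hCE (k n)).integrable_source
        G.continuous.stronglyMeasurable G.exists_forall_norm_le
    rw [hζb.pairing_spaceTimeMeasure hζm G.continuous.stronglyMeasurable G.exists_forall_norm_le]
    simp_rw [e]
    exact hζ G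
  -- optimising the limit of the dual lower bounds recovers the action of the limit
  · refine (totalAction_densityFamily_le hK hμc hwm hwi hzm hzi).trans ?_
    rw [lintegral_norm_sq_eq, lintegral_norm_sq_eq, ← ENNReal.ofReal_mul (by positivity),
      ← ENNReal.ofReal_add (by positivity) (by positivity)]
    refine ENNReal.ofReal_le_of_le_toReal ?_
    refine norm_sq_add_norm_sq_le_of_forall ρ ρ' w z fun F G => ?_
    rw [← hw, ← hz]
    exact hquad F G

end Main

theorem mainTheorem4 {d : ℕ} (D : Set (EuclideanSpace ℝ (Fin d))) (hD : IsOpen D)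
    (hDb : Bornology.IsBounded D) (δ : ℝ) (hδ : 0 < δ)
    (μ : ℕ → I → FiniteMeasure (closure D))
    (ν : ℕ → I → VectorMeasure (closure D) (EuclideanSpace ℝ (Fin d)))
    (ζ : ℕ → I → SignedMeasure (closure D))
    (hCE : ∀ n, ContinuityEquation (closure D) (μ n) (ν n) (ζ n))
    (hA1 : (⨆ n, (μ n 0 : Measure (closure D)) univ) < ∞)
    (hA2 : (⨆ n, totalAction δ (μ n) (ν n) (ζ n)) < ∞) :
    ∃ (k : ℕ → ℕ) (μlim : I → FiniteMeasure (closure D))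
      (νlim : I → VectorMeasure (closure D) (EuclideanSpace ℝ (Fin d)))
      (ζlim : I → SignedMeasure (closure D)),
      StrictMono k ∧
      ContinuityEquation (closure D) μlim νlim ζlim ∧
      (∀ t : I, Tendsto (fun n => μ (k n) t) atTop (𝓝 (μlim t))) ∧
      WeakStarTendsto (fun n => spaceTimeMeasure (ν (k n))) (spaceTimeMeasure νlim) ∧
      WeakStarTendsto (fun n => spaceTimeMeasure (ζ (k n))) (spaceTimeMeasure ζlim) ∧
      totalAction δ μlim νlim ζlim ≤
        liminf (fun n => totalAction δ (μ (k n)) (ν (k n)) (ζ (k n))) atTop := by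
  have hK : IsCompact (closure D) := hDb.isCompact_closure
  set A := (⨆ n, totalAction δ (μ n) (ν n) (ζ n)).toReal
  set M₀ := (⨆ n, (μ n 0 : Measure (closure D)) univ).toReal
  have hA : ∀ n, totalAction δ (μ n) (ν n) (ζ n) ≤ ENNReal.ofReal A := fun n => by
    rw [ENNReal.ofReal_toReal hA2.ne]
    exact le_iSup (fun n => totalAction δ (μ n) (ν n) (ζ n)) n
  have hM₀ : ∀ n, (μ n 0 : Measure (closure D)).real univ ≤ M₀ := fun n =>
    ENNReal.toReal_mono hA1.ne (le_iSup (fun n => (μ n 0 : Measure (closure D)) univ) n)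
  have hA0 : 0 ≤ A := ENNReal.toReal_nonneg
  refine exists_subseq_continuityEquation hK hδ hA0
    (M := (M₀ + A + δ * (lebesgueOn (closure D)).real univ / 4).toNNReal) hCE hA fun n t => ?_
  refine NNReal.le_toNNReal_of_coe_le (((hCE n).mass_le hK hδ hA0 (hA n) t).trans ?_)
  gcongr
  exact hM₀ n
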